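/- There are a deterministic algorithm, formalized as a program for a random access machine whose words have $O(\log n)$ bits, and an absolute constant $c$ with the following property. Let $k \geq 1$ and let $G$ be a finite simple $n$-vertex graph, given by its adjacency matrix, such that at least $n-k$ vertices of $G$ have degree at least $n/2$. Then, given $G$ (but not $k$), the algorithm halts after at most $c\,(n^3+1)$ elementary steps and outputs the adjacency matrix of a graph $G'$ on at most $3k$ vertices such that $G$ is Hamiltonian if and only if $G'$ is Hamiltonian. -/

import Mathlib

/-! A random access machine with words of bounded size, programmed by structured programs.
The machine has registers `reg 0, reg 1, …` (a program mentions only finitely many of them) and a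
memory of cells `mem 0, mem 1, …` that is addressed by computed values. -/

namespace RAM

/-- The contents of the registers and of the memory cells. -/
structure State where
  reg : ℕ → ℕ
  mem : ℕ → ℕ

/-- Expressions: constants, registers, sum, truncated difference, product, and the content of the
memory cell whose address is given by an expression. -/
inductive Expr where
  | const (a : ℕ)
  | reg (r : ℕ)
  | add (e f : Expr)
  | sub (e f : Expr)
  | mul (e f : Expr)
  | load (e : Expr)

/-- The value of an expression. -/
def Expr.val (s : State) : Expr → ℕ
  | .const a => a
  | .reg r => s.reg r
  | .add e f => e.val s + f.val s
  | .sub e f => e.val s - f.val s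
  | .mul e f => e.val s * f.val s
  | .load e => s.mem (e.val s)

/-- The cost of evaluating an expression: one step for each constant, register access, arithmetic
operation and memory access. -/
def Expr.cost : Expr → ℕ
  | .const _ => 1
  | .reg _ => 1
  | .add e f => e.cost + f.cost + 1
  | .sub e f => e.cost + f.cost + 1
  | .mul e f => e.cost + f.cost + 1
  | .load e => e.cost + 1

/-- No overflow: all values that occur in the evaluation of the expression are words, that is,
they are smaller than `W`. -/
def Expr.Fits (W : ℕ) (s : State) : Expr → Prop
  | .const a => a < W
  | .reg r => s.reg r < W
  | .add e f => e.Fits W s ∧ f.Fits W s ∧ e.val s + f.val s < W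
  | .sub e f => e.Fits W s ∧ f.Fits W s
  | .mul e f => e.Fits W s ∧ f.Fits W s ∧ e.val s * f.val s < W
  | .load e => e.Fits W s ∧ s.mem (e.val s) < W

/-- Structured programs. A test succeeds if the value of its expression is not zero. -/
inductive Prog where
  | skip
  | assign (r : ℕ) (e : Expr)
  | store (a e : Expr)
  | seq (p q : Prog)
  | branch (e : Expr) (p q : Prog)
  | loop (e : Expr) (p : Prog)

/-- `Exec W p s t s'`: with words that range over `0, …, W - 1`, the program `p`, started in the
state `s`, halts in the state `s'` after exactly `t` steps. A run in which some value is not a word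
gets stuck, and then no such `t` and `s'` exist. -/
inductive Exec (W : ℕ) : Prog → State → ℕ → State → Prop
  | skip (s : State) : Exec W .skip s 1 s
  | assign (s : State) (r : ℕ) (e : Expr) : e.Fits W s →
      Exec W (.assign r e) s (e.cost + 1) ⟨Function.update s.reg r (e.val s), s.mem⟩
  | store (s : State) (a e : Expr) : a.Fits W s → e.Fits W s →
      Exec W (.store a e) s (a.cost + e.cost + 1)
        ⟨s.reg, Function.update s.mem (a.val s) (e.val s)⟩
  | seq {p q : Prog} {s s' s'' : State} {t t' : ℕ} : Exec W p s t s' → Exec W q s' t' s'' →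
      Exec W (.seq p q) s (t + t') s''
  | branch_true {e : Expr} {p q : Prog} {s s' : State} {t : ℕ} : e.Fits W s → e.val s ≠ 0 →
      Exec W p s t s' → Exec W (.branch e p q) s (e.cost + 1 + t) s'
  | branch_false {e : Expr} {p q : Prog} {s s' : State} {t : ℕ} : e.Fits W s → e.val s = 0 →
      Exec W q s t s' → Exec W (.branch e p q) s (e.cost + 1 + t) s'
  | loop_true {e : Expr} {p : Prog} {s s' s'' : State} {t t' : ℕ} : e.Fits W s → e.val s ≠ 0 →
      Exec W p s t s' → Exec W (.loop e p) s' t' s'' →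
      Exec W (.loop e p) s (e.cost + 1 + t + t') s''
  | loop_false {e : Expr} {p : Prog} {s : State} : e.Fits W s → e.val s = 0 →
      Exec W (.loop e p) s (e.cost + 1) s

/-- The machine is deterministic: the initial state determines the running time and the final
state. -/
theorem Exec.deterministic {W : ℕ} {p : Prog} {s s₁ s₂ : State} {t₁ t₂ : ℕ}
    (h₁ : Exec W p s t₁ s₁) (h₂ : Exec W p s t₂ s₂) : t₁ = t₂ ∧ s₁ = s₂ := by
  induction h₁ generalizing t₂ s₂ with
  | skip => cases h₂; exact ⟨rfl, rfl⟩
  | assign => cases h₂; exact ⟨rfl, rfl⟩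
  | store => cases h₂; exact ⟨rfl, rfl⟩
  | seq _ _ ih ih' =>
    cases h₂ with
    | seq a b =>
      obtain ⟨rfl, rfl⟩ := ih a
      obtain ⟨rfl, rfl⟩ := ih' b
      exact ⟨rfl, rfl⟩
  | branch_true _ hv _ ih =>
    cases h₂ with
    | branch_true _ _ a => obtain ⟨rfl, rfl⟩ := ih a; exact ⟨rfl, rfl⟩
    | branch_false _ hw _ => exact absurd hw hv
  | branch_false _ hv _ ih =>
    cases h₂ with
    | branch_true _ hw _ => exact absurd hv hw
    | branch_false _ _ a => obtain ⟨rfl, rfl⟩ := ih a; exact ⟨rfl, rfl⟩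
  | loop_true _ hv _ _ ih ih' =>
    cases h₂ with
    | loop_true _ _ a b =>
      obtain ⟨rfl, rfl⟩ := ih a
      obtain ⟨rfl, rfl⟩ := ih' b
      exact ⟨rfl, rfl⟩
    | loop_false _ hw => exact absurd hw hv
  | loop_false _ hv =>
    cases h₂ with
    | loop_true _ hw _ _ => exact absurd hv hw
    | loop_false => exact ⟨rfl, rfl⟩

open Classical in
/-- The initial state for the input graph `G` on the vertices `0, …, n - 1`: register `0` contains
`n`, the cells `0, …, n ^ 2 - 1` contain the adjacency matrix of `G` row by row, and all other
registers and cells contain `0`. -/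
noncomputable def input {n : ℕ} (G : SimpleGraph (Fin n)) : State where
  reg r := if r = 0 then n else 0
  mem a := if ∃ i j : Fin n, a = i * n + j ∧ G.Adj i j then 1 else 0

open Classical in
/-- The state `s` contains the graph `G` on the vertices `0, …, m - 1`: register `0` contains `m`,
register `1` contains an address `b`, and the `m ^ 2` cells from `b` on contain the adjacency
matrix of `G` row by row. -/
def State.Contains (s : State) {m : ℕ} (G : SimpleGraph (Fin m)) : Prop :=
  s.reg 0 = m ∧ ∀ i j : Fin m, s.mem (s.reg 1 + i * m + j) = if G.Adj i j then 1 else 0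

end RAM

namespace SimpleGraph

variable {V : Type*}

/-- The vertex `v` followed by the list `l` traverses a cycle of `G` (or an edge back and forth)
that visits exactly the vertices in `U`, each of them once. -/
structure HamCycleOn (G : SimpleGraph V) (U : Finset V) (v : V) (l : List V) : Prop where
  nodup : (v :: l).Nodup
  mem : ∀ x, x ∈ v :: l ↔ x ∈ U
  chain : (v :: (l ++ [v])).IsChain G.Adj

namespace HamCycleOn

variable {G : SimpleGraph V} {U : Finset V} {v : V} {l : List V}

theorem rotate (h : HamCycleOn G U v l) {a b : List V} {x : V} (hl : v :: l = a ++ x :: b) :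
    HamCycleOn G U x (b ++ a) := by
  have hp : (x :: (b ++ a)).Perm (v :: l) := by
    rw [hl]
    exact (List.perm_append_comm (l₁ := x :: b) (l₂ := a))
  refine ⟨hp.nodup_iff.2 h.nodup, fun y => hp.mem_iff.trans (h.mem y), ?_⟩
  cases a with
  | nil =>
    simp only [List.nil_append, List.cons.injEq] at hl
    obtain ⟨rfl, rfl⟩ := hl
    simpa using h.chain
  | cons w a =>
    simp only [List.cons_append, List.cons.injEq] at hl
    obtain ⟨rfl, rfl⟩ := hl
    have hc := h.chain
    have e1 : v :: (a ++ x :: b ++ [v]) = (v :: a) ++ x :: (b ++ [v]) := by simp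
    have e2 : x :: (b ++ v :: a ++ [x]) = (x :: b) ++ v :: (a ++ [x]) := by simp
    rw [e1, List.isChain_split] at hc
    rw [e2, List.isChain_split]
    exact ⟨by simpa using hc.2, by simpa using hc.1⟩

theorem exists_of_mem (h : HamCycleOn G U v l) {x : V} (hx : x ∈ U) :
    ∃ l', HamCycleOn G U x l' := by
  obtain ⟨a, b, hab⟩ := List.append_of_mem ((h.mem x).2 hx)
  exact ⟨_, h.rotate hab⟩

theorem reverse (h : HamCycleOn G U v l) : HamCycleOn G U v l.reverse := by
  have hp : (v :: l.reverse).Perm (v :: l) := List.Perm.cons _ l.reverse_perm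
  refine ⟨hp.nodup_iff.2 h.nodup, fun y => hp.mem_iff.trans (h.mem y), ?_⟩
  have e : v :: (l.reverse ++ [v]) = (v :: (l ++ [v])).reverse := by simp
  rw [e, List.isChain_reverse]
  exact h.chain.imp fun _ _ h => h.symm

theorem swap {x : V} (h : HamCycleOn G U v (x :: l)) : HamCycleOn G U x (v :: l.reverse) := by
  simpa using (h.rotate (a := [v]) (b := l) (x := x) rfl).reverse

theorem length_eq [DecidableEq V] (h : HamCycleOn G U v l) : l.length + 1 = U.card := by
  have : (v :: l).toFinset = U := by
    ext x
    rw [List.mem_toFinset, h.mem]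
  rw [← this, List.toFinset_card_of_nodup h.nodup, List.length_cons]

/-- Replacing the edges `v x` and `p b` of a cycle by `v p` and `x b`. -/
theorem two_opt {x p b : V} {A B : List V} (h : HamCycleOn G U v (x :: (A ++ p :: b :: B)))
    (hvp : G.Adj v p) (hxb : G.Adj x b) :
    HamCycleOn G U v (p :: (A.reverse ++ x :: b :: B)) := by
  have hp : (v :: p :: (A.reverse ++ x :: b :: B)).Perm (v :: x :: (A ++ p :: b :: B)) := by
    have e1 : p :: (A.reverse ++ x :: b :: B) = (x :: (A ++ [p])).reverse ++ b :: B := by simp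
    have e2 : x :: (A ++ p :: b :: B) = (x :: (A ++ [p])) ++ b :: B := by simp
    rw [e1, e2]
    exact ((List.reverse_perm _).append_right _).cons _
  refine ⟨hp.nodup_iff.2 h.nodup, fun y => hp.mem_iff.trans (h.mem y), ?_⟩
  have hc := h.chain
  have e1 : v :: (x :: (A ++ p :: b :: B) ++ [v]) = ([v] ++ x :: (A ++ [p])) ++ b :: (B ++ [v]) := by
    simp
  have e2 : v :: (p :: (A.reverse ++ x :: b :: B) ++ [v])
      = v :: ((x :: (A ++ [p])).reverse ++ b :: (B ++ [v])) := by simp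
  rw [e1] at hc
  have c1 : (x :: (A ++ [p])).IsChain G.Adj := hc.left_of_append.right_of_append
  have c2 := hc.right_of_append
  rw [e2]
  refine List.IsChain.cons (List.IsChain.append ?_ c2 ?_) ?_
  · rw [List.isChain_reverse]
    exact c1.imp fun _ _ h => h.symm
  · simp only [List.getLast?_reverse, List.head?_cons, Option.mem_def, Option.some.injEq]
    rintro _ rfl _ rfl
    exact hxb
  · simp [hvp]

end HamCycleOn

/-- The sum of the weights of the pairs of consecutive elements of a list. -/
def pairSum (w : V → V → ℕ) : List V → ℕ
  | x :: y :: l => w x y + pairSum w (y :: l)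
  | _ => 0

theorem pairSum_append_cons (w : V → V → ℕ) (x : V) (l₁ l₂ : List V) :
    pairSum w (l₁ ++ x :: l₂) = pairSum w (l₁ ++ [x]) + pairSum w (x :: l₂) := by
  induction l₁ with
  | nil => simp [pairSum]
  | cons y l₁ ih =>
    cases l₁ with
    | nil => simp [pairSum]
    | cons z l₁ =>
      simp only [List.cons_append, pairSum] at ih ⊢
      omega

theorem pairSum_reverse {w : V → V → ℕ} (hw : ∀ x y, w x y = w y x) (l : List V) :
    pairSum w l.reverse = pairSum w l := by
  induction l with
  | nil => rfl
  | cons x l ih =>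
    cases l with
    | nil => rfl
    | cons y l =>
      have e : (x :: y :: l).reverse = l.reverse ++ y :: [x] := by simp
      have e' : l.reverse ++ [y] = (y :: l).reverse := by simp
      rw [e, pairSum_append_cons, e', ih]
      simp only [pairSum]
      rw [hw y x]
      omega

theorem isChain_of_pairSum_eq_zero {w : V → V → ℕ} {l : List V} (h : pairSum w l = 0) :
    l.IsChain fun x y => w x y = 0 := by
  induction l with
  | nil => exact .nil
  | cons x l ih =>
    cases l with
    | nil => exact .singleton _
    | cons y l =>
      simp only [pairSum, Nat.add_eq_zero_iff] at h
      exact .cons_cons h.1 (ih h.2)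

theorem exists_of_pairSum_pos {w : V → V → ℕ} {l : List V} (h : 0 < pairSum w l) :
    ∃ a x y b, l = a ++ x :: y :: b ∧ 0 < w x y := by
  induction l with
  | nil => simp [pairSum] at h
  | cons x l ih =>
    cases l with
    | nil => simp [pairSum] at h
    | cons y l =>
      by_cases hw : 0 < w x y
      · exact ⟨[], x, y, l, rfl, hw⟩
      · simp only [pairSum] at h
        obtain ⟨a, x', y', b, e, h'⟩ := ih (by omega)
        exact ⟨x :: a, x', y', b, by rw [e]; rfl, h'⟩

/-- A move that replaces the first edge `v x` of the cycle `v, x, l` and a later edge `p b` by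
`v p` and `x b` and thereby decreases the weight. -/
def HasImprovement (G : SimpleGraph V) (w : V → V → ℕ) (v x : V) (l : List V) : Prop :=
  ∃ A p b B, l = A ++ p :: b :: B ∧ G.Adj v p ∧ G.Adj x b ∧ w v p + w x b < w v x + w p b

namespace HamCycleOn

variable {G : SimpleGraph V} {U : Finset V} {v : V} {l : List V}

theorem exists_pairSum_lt {w : V → V → ℕ} (hw : ∀ x y, w x y = w y x) {x : V}
    (h : HamCycleOn G U v (x :: l)) (hi : HasImprovement G w v x l) :
    ∃ l', HamCycleOn G U v l' ∧
      pairSum w (v :: (l' ++ [v])) < pairSum w (v :: (x :: l ++ [v])) := by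
  obtain ⟨A, p, b, B, rfl, hvp, hxb, hlt⟩ := hi
  refine ⟨_, h.two_opt hvp hxb, ?_⟩
  have e1 : v :: (x :: (A ++ p :: b :: B) ++ [v]) = ([v] ++ x :: (A ++ p :: b :: (B ++ [v]))) := by
    simp
  have e2 : v :: (p :: (A.reverse ++ x :: b :: B) ++ [v])
      = [v] ++ p :: (A.reverse ++ x :: b :: (B ++ [v])) := by simp
  have e3 : ∀ (x p : V) (A D : List V), pairSum w (x :: (A ++ p :: D))
      = pairSum w (x :: (A ++ [p])) + pairSum w (p :: D) := fun x p A D => by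
    simpa using pairSum_append_cons w p (x :: A) D
  have e4 : pairSum w (p :: (A.reverse ++ [x])) = pairSum w (x :: (A ++ [p])) := by
    rw [← pairSum_reverse hw]
    simp
  rw [e1, e2]
  simp only [List.cons_append, List.nil_append, pairSum]
  rw [e3 x p A, e3 p x A.reverse, e4]
  simp only [pairSum]
  omega

theorem pairSum_rotate {w : V → V → ℕ} {a b : List V} {x : V} (hl : v :: l = a ++ x :: b) :
    pairSum w (x :: (b ++ a ++ [x])) = pairSum w (v :: (l ++ [v])) := by
  cases a with
  | nil =>
    simp only [List.nil_append, List.cons.injEq] at hl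
    obtain ⟨rfl, rfl⟩ := hl
    simp
  | cons y a =>
    simp only [List.cons_append, List.cons.injEq] at hl
    obtain ⟨rfl, rfl⟩ := hl
    have e1 : v :: (a ++ x :: b ++ [v]) = (v :: a) ++ x :: (b ++ [v]) := by simp
    have e2 : x :: (b ++ v :: a ++ [x]) = (x :: b) ++ v :: (a ++ [x]) := by simp
    rw [e1, e2, pairSum_append_cons w x (v :: a), pairSum_append_cons w v (x :: b)]
    simp only [List.cons_append]
    omega

/-- If every cycle with an edge of positive weight can be improved, then there is a cycle without
such edges. -/
theorem exists_weight_eq_zero [DecidableEq V] {w : V → V → ℕ} (hw : ∀ x y, w x y = w y x)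
    (himp : ∀ v x, 0 < w v x →
      (∀ l, HamCycleOn G U v (x :: l) → HasImprovement G w v x l) ∨
      (∀ l, HamCycleOn G U x (v :: l) → HasImprovement G w x v l))
    (hU : 2 ≤ U.card) (h : HamCycleOn G U v l) :
    ∃ v' l', HamCycleOn G U v' l' ∧ (v' :: (l' ++ [v'])).IsChain fun x y => w x y = 0 := by
  induction hm : pairSum w (v :: (l ++ [v])) using Nat.strong_induction_on generalizing v l with
  | _ m ih =>
    rcases Nat.eq_zero_or_pos (pairSum w (v :: (l ++ [v]))) with h0 | hpos
    · exact ⟨v, l, h, isChain_of_pairSum_eq_zero h0⟩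
    obtain ⟨a, x, y, b, hab, hxy⟩ := exists_of_pairSum_pos hpos
    obtain ⟨l', hl', hs⟩ : ∃ l', HamCycleOn G U x (y :: l') ∧
        pairSum w (x :: (y :: l' ++ [x])) = m := by
      rcases List.eq_nil_or_concat b with rfl | ⟨b', z, rfl⟩
      · have hab' : (v :: l) ++ [v] = (a ++ [x]) ++ [y] := by simpa using hab
        obtain ⟨h1, h2⟩ := List.append_inj' hab' rfl
        simp only [List.cons.injEq, and_true] at h2
        subst h2
        have hr := h.rotate h1
        have hp := pairSum_rotate (w := w) h1
        cases a with
        | nil =>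
          have := h.length_eq
          have h3 := congrArg List.length h1
          simp at h3
          subst h3
          simp at this
          omega
        | cons z a =>
          simp only [List.cons_append, List.cons.injEq] at h1
          obtain ⟨rfl, rfl⟩ := h1
          exact ⟨a, by simpa using hr, by simpa using hp.trans hm⟩
      · have hab' : (v :: l) ++ [v] = (a ++ x :: y :: b') ++ [z] := by simpa using hab
        obtain ⟨h1, -⟩ := List.append_inj' hab' rfl
        exact ⟨b' ++ a, by simpa using h.rotate h1,
          by simpa using (pairSum_rotate (w := w) h1).trans hm⟩
    rcases himp x y hxy with hi | hi
    · obtain ⟨l'', h1, h2⟩ := hl'.exists_pairSum_lt hw (hi _ hl')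
      exact ih _ (by omega) h1 rfl
    · obtain ⟨l'', h1, h2⟩ := hl'.swap.exists_pairSum_lt hw (hi _ hl'.swap)
      have e : pairSum w (y :: (x :: l'.reverse ++ [y])) = m := by
        rw [← hs, ← pairSum_reverse hw]
        simp only [List.cons_append, List.reverse_cons, List.reverse_append, List.reverse_reverse,
          List.nil_append, List.append_assoc, List.reverse_nil]
        have := pairSum_append_cons w x (y :: l') [y]
        simp only [List.cons_append, pairSum] at this ⊢
        rw [this, hw x y]
        omega
      exact ih _ (by omega) h1 rfl

end HamCycleOn

theorem countP_add_countP_le (P Q : V → Bool) (x : V) (l : List V)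
    (h : ∀ A p b B, x :: l = A ++ p :: b :: B → P p = true → Q b = false) :
    (x :: l).countP P + (x :: l).countP Q ≤ l.length + 1 + if Q x then 1 else 0 := by
  induction l generalizing x with
  | nil => cases hP : P x <;> cases hQ : Q x <;> simp [hP, hQ]
  | cons y l ih =>
    have := ih y fun A p b B e => h (x :: A) p b B (by rw [e]; rfl)
    have h0 := h [] x y l rfl
    rw [List.countP_cons, List.countP_cons (p := Q), List.length_cons]
    cases hP : P x <;> cases hQ : Q y <;> cases hQ' : Q x <;> simp_all <;> omega

namespace HamCycleOn

variable {G : SimpleGraph V} {U : Finset V} {v : V} {l : List V}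

theorem countP_eq [DecidableEq V] (h : HamCycleOn G U v l) (P : V → Prop) [DecidablePred P] :
    (v :: l).countP (fun x => decide (P x)) = (U.filter P).card := by
  have : ((v :: l).filter fun x => decide (P x)).toFinset = U.filter P := by
    ext x
    rw [List.mem_toFinset, List.mem_filter, h.mem, Finset.mem_filter]
    simp
  rw [← this, List.toFinset_card_of_nodup (h.nodup.filter _), List.countP_eq_length_filter]

end HamCycleOn

end SimpleGraph

namespace SimpleGraph

variable {V : Type*} [DecidableEq V]

theorem isHamiltonian_iff_exists_hamCycleOn [Fintype V] {G : SimpleGraph V}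
    (hV : 3 ≤ Fintype.card V) :
    G.IsHamiltonian ↔ ∃ v l, HamCycleOn G Finset.univ v l := by
  constructor
  · intro h
    obtain ⟨v, p, hp⟩ := h (by omega)
    cases p with
    | nil => exact absurd rfl hp.isCycle.ne_nil
    | cons hvw q =>
      have hq : q.IsHamiltonian := by
        have := hp.isHamiltonian_tail
        simpa [Walk.IsHamiltonian] using this
      have hn := hq.isPath.support_nodup
      have hc := (Walk.cons hvw q).isChain_adj_support
      obtain ⟨l, hl⟩ : ∃ l, q.support = l ++ [v] :=
        ⟨q.support.dropLast, by
          have := List.dropLast_append_getLast q.support_ne_nil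
          rw [q.getLast_support] at this
          exact this.symm⟩
      rw [Walk.support_cons, hl] at hc
      have hperm : (v :: l).Perm q.support := by
        rw [hl]
        exact (List.perm_append_comm (l₁ := [v]) (l₂ := l))
      exact ⟨v, l, hperm.nodup_iff.2 hn, fun x => by simp [hperm.mem_iff, hq.mem_support x], hc⟩
  · rintro ⟨v, l, h⟩ -
    have hlen := h.length_eq
    rw [Finset.card_univ] at hlen
    cases l with
    | nil => simp at hlen; omega
    | cons x l =>
      have hc := h.chain
      have hvx : G.Adj v x := by
        simp only [List.cons_append, List.isChain_cons_cons] at hc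
        exact hc.1
      have hc' : (x :: (l ++ [v])).IsChain G.Adj := by
        simp only [List.cons_append, List.isChain_cons_cons] at hc
        exact hc.2
      let q₀ := Walk.ofSupport (x :: (l ++ [v])) (by simp) hc'
      let q : G.Walk x v := q₀.copy (by simp) (by simp)
      have hqs : q.support = x :: (l ++ [v]) := by
        exact (Walk.support_copy _ _ _).trans (Walk.support_ofSupport _ _)
      have hql : q.length = l.length + 1 := by
        have := q.length_support
        rw [hqs] at this
        simp at this
        omega
      have hperm : (x :: (l ++ [v])).Perm (v :: x :: l) :=
        (List.perm_append_comm (l₁ := x :: l) (l₂ := [v]))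
      refine ⟨v, Walk.cons hvx q, (Walk.isHamiltonianCycle_iff_isCycle_and_length_eq).2 ⟨?_, ?_⟩⟩
      · rw [Walk.isCycle_iff_isPath_tail_and_le_length]
        constructor
        · rw [Walk.isPath_def]
          have := hperm.nodup_iff.2 h.nodup
          rw [← hqs] at this
          simpa using this
        · rw [Walk.length_cons, hql]
          simp at hlen
          omega
      · rw [Walk.length_cons, hql, ← hlen]
        rfl

/-- The graph that results from `G` when the vertices in `C` are made pairwise adjacent. -/
def addClique (G : SimpleGraph V) (C : Finset V) : SimpleGraph V where
  Adj x y := x ≠ y ∧ (G.Adj x y ∨ x ∈ C ∧ y ∈ C)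
  symm := ⟨fun _ _ h => ⟨h.1.symm, h.2.imp (fun h => h.symm) And.symm⟩⟩
  loopless := ⟨fun _ h => h.1 rfl⟩

omit [DecidableEq V] in
theorem le_addClique (G : SimpleGraph V) (C : Finset V) : G ≤ G.addClique C :=
  fun _ _ h => ⟨h.ne, Or.inl h⟩

omit [DecidableEq V] in
theorem HamCycleOn.mono {G H : SimpleGraph V} (hGH : G ≤ H) {U : Finset V} {v : V} {l : List V}
    (h : HamCycleOn G U v l) : HamCycleOn H U v l :=
  ⟨h.nodup, h.mem, h.chain.imp fun _ _ hab => hGH hab⟩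

omit [DecidableEq V] in
theorem HamCycleOn.of_isChain {G H : SimpleGraph V} {U : Finset V} {v : V} {l : List V}
    (h : HamCycleOn G U v l) {r : V → V → Prop} (hr : (v :: (l ++ [v])).IsChain r)
    (hrG : ∀ x y, G.Adj x y → r x y → H.Adj x y) : HamCycleOn H U v l := by
  refine ⟨h.nodup, h.mem, ?_⟩
  have hc := h.chain
  rw [List.isChain_iff_forall_rel_of_append_cons_cons] at hc hr ⊢
  exact fun _ _ _ _ e => hrG _ _ (hc e) (hr e)

open Classical in
/-- A case of the theorem of Bondy and Chvátal: vertices whose degree is at least half the order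
of the graph can be made pairwise adjacent. -/
theorem exists_hamCycleOn_addClique_iff [Fintype V] (G : SimpleGraph V) [DecidableRel G.Adj]
    {C : Finset V} (hC : ∀ v ∈ C, Fintype.card V ≤ 2 * G.degree v) (hV : 2 ≤ Fintype.card V) :
    (∃ v l, HamCycleOn (G.addClique C) Finset.univ v l) ↔
      ∃ v l, HamCycleOn G Finset.univ v l := by
  refine ⟨?_, fun ⟨v, l, h⟩ => ⟨v, l, h.mono (G.le_addClique C)⟩⟩
  rintro ⟨v, l, h⟩
  let w : V → V → ℕ := fun x y => if (G.addClique C).Adj x y ∧ ¬ G.Adj x y then 1 else 0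
  have hw : ∀ x y, w x y = w y x := fun x y => by simp only [w, SimpleGraph.adj_comm]
  have himp : ∀ v x, 0 < w v x → ∀ l, HamCycleOn (G.addClique C) Finset.univ v (x :: l) →
      HasImprovement (G.addClique C) w v x l := by
    intro v x hvx l hl
    have hvx' : (G.addClique C).Adj v x ∧ ¬ G.Adj v x := by
      by_contra hn
      simp [w, hn] at hvx
    obtain ⟨⟨hne, hor⟩, hG⟩ := hvx'
    have hvC : v ∈ C ∧ x ∈ C := hor.resolve_left hG
    by_contra hno
    have hlen := hl.length_eq
    rw [Finset.card_univ, List.length_cons] at hlen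
    have key : ∀ (P : V → Prop) [DecidablePred P], ¬ P v → ¬ P x →
        l.countP (fun x => decide (P x)) = (Finset.univ.filter P).card := by
      intro P _ h1 h2
      rw [← hl.countP_eq P, List.countP_cons_of_neg (by simpa), List.countP_cons_of_neg (by simpa)]
    have kv := key (G.Adj v) (by simp) hG
    have kx := key (G.Adj x) (fun h => hG h.symm) (by simp)
    have dv := hC v hvC.1
    have dx := hC x hvC.2
    rw [← G.card_neighborFinset_eq_degree, G.neighborFinset_eq_filter] at dv dx
    rw [← kv] at dv
    rw [← kx] at dx
    cases l with
    | nil => simp at dv; omega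
    | cons y l =>
      have := countP_add_countP_le (fun z => decide (G.Adj v z)) (fun z => decide (G.Adj x z)) y l ?_
      · simp only [List.length_cons] at hlen
        split_ifs at this <;> omega
      · intro A p b B e hp
        by_contra hb
        simp only [Bool.not_eq_false, decide_eq_true_eq] at hp hb
        refine hno ⟨A, p, b, B, e, G.le_addClique C hp, G.le_addClique C hb, ?_⟩
        have : w v x = 1 := by simp [w, addClique, hne, hvC, hG]
        simp [w, hp, hb, hvx]
  obtain ⟨v', l', h', hz⟩ :=
    h.exists_weight_eq_zero hw (fun v x hvx => Or.inl (himp v x hvx)) (by simpa)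
  refine ⟨v', l', h'.of_isChain hz fun x y hxy hxy0 => ?_⟩
  by_contra hn
  simp [w, hxy, hn] at hxy0

end SimpleGraph

namespace SimpleGraph

variable {V : Type*} [DecidableEq V]

/-- Vertices outside `U` can be inserted into a cycle on `U` if they and more than half of the
vertices of `U` lie in a clique. -/
theorem HamCycleOn.exists_insert [Fintype V] {G : SimpleGraph V} {C U : Finset V}
    (hC : ∀ x ∈ C, ∀ y ∈ C, x ≠ y → G.Adj x y) (hUC : Uᶜ ⊆ C)
    (hcard : (U.filter (· ∉ C)).card < (U.filter (· ∈ C)).card) (hU : 2 ≤ U.card)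
    {v : V} {l : List V} (h : HamCycleOn G U v l) :
    ∃ v l, HamCycleOn G Finset.univ v l := by
  obtain ⟨x, y, l', h', hx, hy⟩ : ∃ x y l', HamCycleOn G U x (y :: l') ∧ x ∈ C ∧ y ∈ C := by
    by_cases hS : ∃ z ∈ U, z ∉ C
    · obtain ⟨z, hzU, hzC⟩ := hS
      obtain ⟨l', h'⟩ := h.exists_of_mem hzU
      by_contra hno
      have := countP_add_countP_le (fun x => decide (x ∈ C)) (fun x => decide (x ∈ C)) z l' ?_
      · rw [h'.countP_eq (· ∈ C), h'.length_eq, ← U.card_filter_add_card_filter_not (· ∈ C)] at this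
        simp only [hzC, decide_false, Bool.false_eq_true, if_false] at this
        omega
      · intro A p b B e hp
        by_contra hb
        simp only [Bool.not_eq_false, decide_eq_true_eq] at hp hb
        exact hno ⟨p, b, B ++ A, by simpa using h'.rotate e, hp, hb⟩
    · push Not at hS
      have hlen := h.length_eq
      cases l with
      | nil => simp at hlen; omega
      | cons y l =>
        exact ⟨v, y, l, h, hS v ((h.mem v).1 (by simp)), hS y ((h.mem y).1 (by simp))⟩
  have hperm : (x :: ((Uᶜ).toList ++ y :: l')).Perm ((x :: y :: l') ++ (Uᶜ).toList) :=
    (List.perm_append_comm (l₁ := (Uᶜ).toList) (l₂ := y :: l')).cons x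
  refine ⟨x, (Uᶜ).toList ++ y :: l', hperm.nodup_iff.2 ?_, fun z => ?_, ?_⟩
  · refine List.nodup_append'.2 ⟨h'.nodup, Finset.nodup_toList _, fun z hz hz' => ?_⟩
    rw [h'.mem] at hz
    simp [hz] at hz'
  · rw [hperm.mem_iff, List.mem_append, h'.mem]
    simp [em]
  · have hc := h'.chain
    have hn : (x :: ((Uᶜ).toList ++ [y])).Nodup := by
      have := hperm.nodup_iff.2 (List.nodup_append'.2 ⟨h'.nodup, Finset.nodup_toList (Uᶜ),
        fun z hz hz' => by rw [h'.mem] at hz; simp [hz] at hz'⟩)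
      refine this.sublist ?_
      exact List.Sublist.cons_cons _ ((List.Sublist.refl _).append
        (List.Sublist.cons_cons _ (List.nil_sublist _)))
    have hmem : ∀ z ∈ x :: ((Uᶜ).toList ++ [y]), z ∈ C := by
      intro z hz
      simp only [List.mem_cons, List.mem_append, Finset.mem_toList, List.not_mem_nil,
        or_false] at hz
      rcases hz with rfl | hz | rfl
      · exact hx
      · exact hUC hz
      · exact hy
    have hcl : (x :: ((Uᶜ).toList ++ [y])).IsChain G.Adj :=
      (hn.imp_of_mem fun ha hb hab => hC _ (hmem _ ha) _ (hmem _ hb) hab).isChain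
    have e : x :: ((Uᶜ).toList ++ y :: l' ++ [x]) = (x :: (Uᶜ).toList) ++ y :: (l' ++ [x]) := by
      simp
    rw [e, List.isChain_split]
    simp only [List.cons_append, List.isChain_cons_cons] at hc
    exact ⟨hcl, hc.2⟩

/-- A vertex whose neighbours form a clique can be skipped by a cycle of length at least `4`. -/
theorem HamCycleOn.exists_erase {G : SimpleGraph V} {K U : Finset V}
    (hK : ∀ x ∈ K, ∀ y ∈ K, x ≠ y → G.Adj x y) {c : V} (hc : c ∈ U)
    (hcK : ∀ x, G.Adj c x → x ∈ K) (hU : 3 < U.card) {v : V} {l : List V}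
    (h : HamCycleOn G U v l) : ∃ v l, HamCycleOn G (U.erase c) v l := by
  obtain ⟨l, h⟩ := h.exists_of_mem hc
  have hlen := h.length_eq
  cases l with
  | nil => simp at hlen; omega
  | cons x l =>
    rcases List.eq_nil_or_concat l with rfl | ⟨m, y, rfl⟩
    · simp at hlen; omega
    rw [List.concat_eq_append] at *
    have hn := h.nodup
    have hch := h.chain
    refine ⟨x, m ++ [y], (List.nodup_cons.1 hn).2, fun z => ?_, ?_⟩
    · rw [Finset.mem_erase, ← h.mem, List.mem_cons (a := z) (b := c)]
      refine ⟨fun hz => ⟨?_, Or.inr hz⟩, fun hz => hz.2.resolve_left hz.1⟩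
      rintro rfl
      exact (List.nodup_cons.1 hn).1 hz
    · have e : c :: (x :: (m ++ [y]) ++ [c]) = [c] ++ x :: (m ++ y :: [c]) := by simp
      have e2 : x :: (m ++ y :: [c]) = (x :: m) ++ y :: [c] := by simp
      have e3 : x :: (m ++ [y] ++ [x]) = (x :: m) ++ y :: [x] := by simp
      rw [e, List.isChain_split, e2, List.isChain_split (l₁ := x :: m)] at hch
      rw [e3, List.isChain_split]
      refine ⟨hch.2.1, ?_⟩
      have hcx : G.Adj c x := by simpa using hch.1
      have hyc : G.Adj y c := by simpa using hch.2.2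
      have hxy : x ≠ y := by
        rintro rfl
        simp at hn
      simpa using hK y (hcK y hyc.symm) x (hcK x hcx) hxy.symm

theorem HamCycleOn.exists_sdiff {G : SimpleGraph V} {K U : Finset V}
    (hK : ∀ x ∈ K, ∀ y ∈ K, x ≠ y → G.Adj x y) (D : Finset V) (hDU : D ⊆ U)
    (hDK : ∀ c ∈ D, ∀ x, G.Adj c x → x ∈ K) (hU : 3 ≤ (U \ D).card) {v : V} {l : List V}
    (h : HamCycleOn G U v l) : ∃ v l, HamCycleOn G (U \ D) v l := by
  induction D using Finset.induction_on with
  | empty => exact ⟨v, l, by simpa⟩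
  | insert c D hcD ih =>
    have hcU : c ∈ U \ D := Finset.mem_sdiff.2 ⟨hDU (Finset.mem_insert_self c D), hcD⟩
    rw [Finset.sdiff_insert, Finset.card_erase_of_mem hcU] at hU
    obtain ⟨v', l', h'⟩ := ih (fun x hx => hDU (Finset.mem_insert_of_mem hx))
      (fun c hc => hDK c (Finset.mem_insert_of_mem hc)) (by omega)
    rw [Finset.sdiff_insert]
    exact h'.exists_erase hK hcU (hDK c (Finset.mem_insert_self c D)) (by omega)

omit [DecidableEq V] in
theorem exists_append_cons_cons {l : List V} {p q : V} (hpq : p ≠ q) (hp : p ∈ l) (hq : q ∈ l) :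
    ∃ r, (r = p ∨ r = q) ∧ ∃ A b B, l = A ++ r :: b :: B := by
  obtain ⟨A, D, rfl⟩ := List.append_of_mem hp
  cases D with
  | cons b B => exact ⟨p, Or.inl rfl, A, b, B, rfl⟩
  | nil =>
    have hqA : q ∈ A := by
      simp only [List.mem_append, List.mem_cons, List.not_mem_nil, or_false] at hq
      exact hq.resolve_right hpq.symm
    obtain ⟨A', D', rfl⟩ := List.append_of_mem hqA
    cases D' with
    | nil => exact ⟨q, Or.inr rfl, A', p, [], by simp⟩
    | cons b B => exact ⟨q, Or.inr rfl, A', b, B ++ [p], by simp⟩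

open Classical in
/-- Let `C` be a clique and let `C'` be a subset of it. Suppose that each vertex outside of `C`
either has all its neighbours in `C` within `Z ⊆ C'`, or has two private partners in `C' \ Z`.
Then the vertices in `C \ C'` are irrelevant for Hamiltonicity. -/
theorem exists_hamCycleOn_univ_iff [Fintype V] {H : SimpleGraph V} {C C' Z R : Finset V}
    {P : V → V → Prop} (hC : ∀ x ∈ C, ∀ y ∈ C, x ≠ y → H.Adj x y) (hC' : C' ⊆ C) (hZ : Z ⊆ C')
    (hRC : Disjoint R C) (hR : ∀ v, v ∉ C → v ∉ R → ∀ c ∈ C, H.Adj v c → c ∈ Z)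
    (hP : ∀ v p, P v p → p ∈ C' ∧ p ∉ Z ∧ H.Adj v p)
    (hPu : ∀ v v' p, P v p → P v' p → v = v')
    (hRP : ∀ v ∈ R, ∃ p q, p ≠ q ∧ P v p ∧ P v q)
    (hcard : (Cᶜ).card < C'.card) (hU : 3 ≤ (Cᶜ ∪ C').card) :
    (∃ v l, HamCycleOn H Finset.univ v l) ↔ ∃ v l, HamCycleOn H (Cᶜ ∪ C') v l := by
  have hmU : ∀ x, x ∈ Cᶜ ∪ C' ↔ x ∈ C → x ∈ C' := fun x => by
    simp only [Finset.mem_union, Finset.mem_compl]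
    tauto
  constructor
  swap
  · rintro ⟨v, l, h⟩
    refine h.exists_insert hC (fun x hx => ?_) ?_ (by omega)
    · rw [Finset.mem_compl, hmU] at hx
      tauto
    · have e1 : (Cᶜ ∪ C').filter (· ∉ C) = Cᶜ := by
        ext x
        rw [Finset.mem_filter, hmU, Finset.mem_compl]
        tauto
      have e2 : (Cᶜ ∪ C').filter (· ∈ C) = C' := by
        ext x
        rw [Finset.mem_filter, hmU]
        have := @hC' x
        tauto
      rw [e1, e2]
      exact hcard
  rintro ⟨v, l, h⟩
  let K := R ∪ C
  have hKa : ∀ x ∈ K, ∀ y ∈ K, x ≠ y → (H.addClique K).Adj x y :=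
    fun x hx y hy hxy => ⟨hxy, Or.inr ⟨hx, hy⟩⟩
  have hRC' : ∀ x ∈ R, x ∉ C := fun x hx hx' => Finset.disjoint_left.1 hRC hx hx'
  obtain ⟨v, l, h⟩ : ∃ v l, HamCycleOn (H.addClique K) (Cᶜ ∪ C') v l := by
    have e : Finset.univ \ (C \ C') = Cᶜ ∪ C' := by
      ext x
      rw [hmU, Finset.mem_sdiff, Finset.mem_sdiff]
      simp only [Finset.mem_univ, true_and]
      tauto
    rw [← e]
    refine (h.mono (H.le_addClique K)).exists_sdiff hKa (C \ C') (Finset.subset_univ _) ?_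
      (by rwa [e])
    intro c hc x hcx
    rw [Finset.mem_sdiff] at hc
    by_contra hx
    simp only [K, Finset.mem_union, not_or] at hx
    refine hc.2 (hZ (hR x hx.2 hx.1 c hc.1 ?_))
    rcases hcx.2 with h1 | h1
    · exact h1.symm
    · simp [K, hx] at h1
  let w : V → V → ℕ := fun x y =>
    if x ∈ R ∧ y ∈ R then (if H.Adj x y then 0 else 2)
    else if (x ∈ R ∧ y ∈ C ∧ ¬ P x y) ∨ (y ∈ R ∧ x ∈ C ∧ ¬ P y x) then 1 else 0
  have hw : ∀ x y, w x y = w y x := fun x y => by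
    simp only [w, H.adj_comm x y, and_comm (a := x ∈ R) (b := y ∈ R),
      or_comm (a := x ∈ R ∧ y ∈ C ∧ ¬ P x y)]
  have himp : ∀ v x, v ∈ R → 0 < w v x → ∀ l, HamCycleOn (H.addClique K) (Cᶜ ∪ C') v (x :: l) →
      HasImprovement (H.addClique K) w v x l := by
    intro v x hv hvx l hl
    have hvC := hRC' v hv
    have hx : ¬ P v x ∧ x ∈ K := by
      by_cases hxR : x ∈ R
      · exact ⟨fun hp => hRC' x hxR (hC' (hP _ _ hp).1), Finset.mem_union_left _ hxR⟩
      · simp only [w, hxR, and_false, if_false, false_and, or_false] at hvx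
        split_ifs at hvx with h1
        · exact ⟨h1.2.2, Finset.mem_union_right _ h1.2.1⟩
        · omega
    have hPl : ∀ p, P v p → p ∈ l := by
      intro p hp
      have h1 : p ∈ v :: x :: l := (hl.mem p).2 (Finset.mem_union_right _ (hP _ _ hp).1)
      simp only [List.mem_cons] at h1
      rcases h1 with rfl | rfl | h1
      · exact absurd (hC' (hP _ _ hp).1) hvC
      · exact absurd hp hx.1
      · exact h1
    obtain ⟨p₁, p₂, hne, hp₁, hp₂⟩ := hRP v hv
    obtain ⟨p, hp, A, b, B, rfl⟩ := exists_append_cons_cons hne (hPl _ hp₁) (hPl _ hp₂)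
    replace hp : P v p := by rcases hp with rfl | rfl <;> assumption
    have hpC : p ∈ C := hC' (hP _ _ hp).1
    have hpR : p ∉ R := fun h => hRC' p h hpC
    have hn := hl.nodup
    have hbv : v ≠ b := by
      rintro rfl
      simp at hn
    have hxb : x ≠ b := by
      rintro rfl
      simp at hn
    have hpb : (H.addClique K).Adj p b := by
      have hc := hl.chain
      have e : v :: (x :: (A ++ p :: b :: B) ++ [v]) = (v :: x :: A) ++ p :: b :: (B ++ [v]) := by
        simp
      rw [e, List.isChain_split] at hc
      simpa using (List.isChain_cons_cons.1 hc.2).1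
    have hbK : b ∈ K := by
      by_contra hb
      simp only [K, Finset.mem_union, not_or] at hb
      refine (hP _ _ hp).2.1 (hR b hb.2 hb.1 p hpC ?_)
      rcases hpb.2 with h1 | h1
      · exact h1.symm
      · simp [K, hb] at h1
    refine ⟨A, p, b, B, rfl, H.le_addClique K (hP _ _ hp).2.2, hKa x hx.2 b hbK hxb, ?_⟩
    have w1 : w v p = 0 := by simp [w, hpR, hp, hvC]
    by_cases hbR : b ∈ R
    · have hbC := hRC' b hbR
      have hPb : ¬ P b p := fun h => hbv (hPu _ _ _ hp h)
      have w2 : w p b = 1 := by simp [w, hpR, hbR, hpC, hPb]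
      by_cases hxR : x ∈ R
      · have : w v x = 2 := by
          simp only [w, hv, hxR, and_self, if_true] at hvx ⊢
          split_ifs at hvx ⊢
          · omega
          · rfl
        have : w x b ≤ 2 := by simp only [w]; split_ifs <;> omega
        omega
      · have : w x b ≤ 1 := by simp only [w, hxR, false_and, if_false]; split_ifs <;> omega
        omega
    · have hbC : b ∈ C := (Finset.mem_union.1 hbK).resolve_left hbR
      by_cases hxR : x ∈ R
      · have : w v x = 2 := by
          simp only [w, hv, hxR, and_self, if_true] at hvx ⊢
          split_ifs at hvx ⊢
          · omega
          · rfl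
        have : w x b ≤ 1 := by simp only [w, hbR, and_false, if_false]; split_ifs <;> omega
        omega
      · have : w x b = 0 := by simp [w, hbR, hxR]
        omega
  have himp' : ∀ v x, 0 < w v x →
      (∀ l, HamCycleOn (H.addClique K) (Cᶜ ∪ C') v (x :: l) →
        HasImprovement (H.addClique K) w v x l) ∨
      (∀ l, HamCycleOn (H.addClique K) (Cᶜ ∪ C') x (v :: l) →
        HasImprovement (H.addClique K) w x v l) := by
    intro v x hvx
    by_cases hvR : v ∈ R
    · exact Or.inl (himp v x hvR hvx)
    · refine Or.inr (himp x v ?_ (by rwa [hw]))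
      by_contra hxR
      simp [w, hvR, hxR] at hvx
  obtain ⟨v', l', h', hz⟩ := h.exists_weight_eq_zero hw himp' (by omega)
  refine ⟨v', l', h'.of_isChain hz fun x y hxy hxy0 => ?_⟩
  obtain ⟨hne, h1 | h1⟩ := hxy
  · exact h1
  simp only [K, Finset.mem_union] at h1
  by_cases hxR : x ∈ R <;> by_cases hyR : y ∈ R
  · simpa [w, hxR, hyR] using hxy0
  · have : P x y := by
      have hyC := h1.2.resolve_left hyR
      simpa [w, hxR, hyR, hyC] using hxy0
    exact (hP _ _ this).2.2
  · have : P y x := by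
      have hxC := h1.1.resolve_left hxR
      simpa [w, hxR, hyR, hxC] using hxy0
    exact (hP _ _ this).2.2.symm
  · exact hC x (h1.1.resolve_left hxR) y (h1.2.resolve_left hyR) hne

omit [DecidableEq V] in
/-- Transport of cycles along an induced embedding. -/
theorem exists_hamCycleOn_univ_comap_iff {W : Type*} [Fintype W] {G : SimpleGraph V}
    {U : Finset V} (e : W ↪ V) (he : ∀ x, x ∈ U ↔ ∃ i, e i = x) :
    (∃ v l, HamCycleOn (G.comap e) Finset.univ v l) ↔ ∃ v l, HamCycleOn G U v l := by
  have key : ∀ v l, HamCycleOn (G.comap e) Finset.univ v l ↔ HamCycleOn G U (e v) (l.map e) := by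
    intro v l
    have h1 : (e v :: l.map e) = (v :: l).map e := rfl
    have h2 : (e v :: (l.map e ++ [e v])) = (v :: (l ++ [v])).map e := by simp
    constructor
    · intro h
      refine ⟨?_, fun x => ?_, ?_⟩
      · rw [h1]
        exact h.nodup.map e.injective
      · rw [h1, List.mem_map, he]
        exact exists_congr fun i => by simp [(h.mem i).2 (Finset.mem_univ i)]
      · rw [h2, List.isChain_map]
        exact h.chain
    · intro h
      refine ⟨?_, fun x => ?_, ?_⟩
      · have := h.nodup
        rw [h1] at this
        exact this.of_map
      · have := (h.mem (e x)).2 ((he _).2 ⟨x, rfl⟩)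
        rw [h1, List.mem_map_of_injective e.injective] at this
        simp [this]
      · have := h.chain
        rw [h2, List.isChain_map] at this
        exact this
  constructor
  · rintro ⟨v, l, h⟩
    exact ⟨_, _, (key v l).1 h⟩
  · rintro ⟨v, l, h⟩
    obtain ⟨L, hL⟩ : ∃ L : List W, L.map e = v :: l := by
      have : v :: l ∈ Set.range (List.map e) := by
        rw [Set.range_list_map]
        exact fun x hx => (he x).1 ((h.mem x).1 hx)
      exact this
    cases L with
    | nil => simp at hL
    | cons i L =>
      simp only [List.map_cons, List.cons.injEq] at hL
      obtain ⟨rfl, rfl⟩ := hL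
      exact ⟨i, L, (key i L).2 h⟩

end SimpleGraph

open Classical in
/-- The number of tokens that the vertex `v` has received when the first `x` of the tokens
`0, …, n - 1, 0, …, n - 1` have been issued. -/
noncomputable def tokenCount (n x v : ℕ) : ℕ :=
  (if v < x then 1 else 0) + if n + v < x then 1 else 0

open Classical in
/-- The invariant of an auction in which the vertices without the property `hi` buy adjacent
vertices that have it. The vertex `owner c - 1` has bought `c`, unless `owner c = 0`. The first `x`
tokens have been issued, and the vertex `y - 1` is the next one to bid, unless `y = 0`. -/
structure AuctionInv (n : ℕ) (adj : ℕ → ℕ → Prop) (hi : ℕ → Prop) (price owner : ℕ → ℕ)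
    (x y : ℕ) : Prop where
  owner_eq_zero : ∀ c < n, owner c = 0 ↔ price c = 0
  price_le : ∀ c < n, price c ≤ n + 2
  adj_of_owner : ∀ c < n, ∀ v, owner c = v + 1 → v < n ∧ ¬ hi v ∧ hi c ∧ adj v c
  slack : ∀ c < n, ∀ v, owner c = v + 1 → ∀ d < n, hi d → adj v d → price c ≤ price d + 1
  active : ∀ v, y = v + 1 → v < n ∧ ¬ hi v
  count_le : ∀ v < n, ¬ hi v →
    ((Finset.range n).filter fun c => owner c = v + 1).card + (if y = v + 1 then 1 else 0)
      ≤ tokenCount n x v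
  count_or : ∀ v < n, ¬ hi v →
    ((Finset.range n).filter fun c => owner c = v + 1).card + (if y = v + 1 then 1 else 0)
      = tokenCount n x v ∨ ∀ d < n, hi d → adj v d → n + 2 ≤ price d

theorem card_filter_update {n c : ℕ} (hc : c < n) (f : ℕ → ℕ) (b k : ℕ) :
    ((Finset.range n).filter fun i => Function.update f c b i = k).card
        + (if f c = k then 1 else 0)
      = ((Finset.range n).filter fun i => f i = k).card + if b = k then 1 else 0 := by
  have hc' : c ∈ Finset.range n := Finset.mem_range.2 hc
  rw [Finset.card_filter, Finset.card_filter, ← Finset.add_sum_erase _ _ hc',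
    ← Finset.add_sum_erase _ _ hc', Function.update_self]
  have : ∑ i ∈ (Finset.range n).erase c, (if Function.update f c b i = k then 1 else 0)
      = ∑ i ∈ (Finset.range n).erase c, if f i = k then 1 else 0 :=
    Finset.sum_congr rfl fun i hi => by rw [Function.update_of_ne (Finset.ne_of_mem_erase hi)]
  rw [this]
  omega

/-- The total amount by which the prices can still be raised. -/
def auctionSlack (n : ℕ) (price : ℕ → ℕ) : ℕ :=
  ∑ c ∈ Finset.range n, (n + 2 - price c)

theorem auctionSlack_update {n c : ℕ} (hc : c < n) {price : ℕ → ℕ} (hp : price c < n + 2) :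
    auctionSlack n (Function.update price c (price c + 1)) + 1 = auctionSlack n price := by
  have hc' : c ∈ Finset.range n := Finset.mem_range.2 hc
  rw [auctionSlack, auctionSlack, ← Finset.add_sum_erase _ _ hc',
    ← Finset.add_sum_erase _ _ hc', Function.update_self]
  have : ∑ i ∈ (Finset.range n).erase c, (n + 2 - Function.update price c (price c + 1) i)
      = ∑ i ∈ (Finset.range n).erase c, (n + 2 - price i) :=
    Finset.sum_congr rfl fun i hi => by rw [Function.update_of_ne (Finset.ne_of_mem_erase hi)]
  rw [this]
  omega

theorem auctionSlack_le (n : ℕ) (price : ℕ → ℕ) : auctionSlack n price ≤ n * (n + 2) := by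
  refine (Finset.sum_le_card_nsmul _ _ (n + 2) fun i _ => Nat.sub_le _ _).trans ?_
  simp

namespace AuctionInv

variable {n : ℕ} {adj : ℕ → ℕ → Prop} {hi : ℕ → Prop} {price owner : ℕ → ℕ} {x y : ℕ}

theorem init (n : ℕ) (adj : ℕ → ℕ → Prop) (hi : ℕ → Prop) {price owner : ℕ → ℕ}
    (hp : ∀ c < n, price c = 0) (ho : ∀ c < n, owner c = 0) :
    AuctionInv n adj hi price owner 0 0 := by
  have h0 : ∀ v, ((Finset.range n).filter fun c => owner c = v + 1) = ∅ := fun v =>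
    Finset.filter_eq_empty_iff.2 fun c hc => by rw [ho c (Finset.mem_range.1 hc)]; omega
  refine ⟨fun c hc => by simp [hp c hc, ho c hc], fun c hc => by simp [hp c hc],
    fun c hc v h => ?_, fun c hc v h => ?_, fun v h => ?_, fun v _ _ => ?_, fun v _ _ => ?_⟩
  · rw [ho c hc] at h; omega
  · rw [ho c hc] at h; omega
  · omega
  · simp [h0]
  · simp [h0, tokenCount]

theorem skip (h : AuctionInv n adj hi price owner x 0) {u : ℕ}
    (hu : u = if x < n then x else x - n) (hh : hi u) :
    AuctionInv n adj hi price owner (x + 1) 0 := by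
  have ht : ∀ v < n, ¬ hi v → tokenCount n (x + 1) v = tokenCount n x v := by
    intro v hv hv'
    have hne : v ≠ u := fun e => hv' (e ▸ hh)
    rw [hu] at hne
    unfold tokenCount
    split_ifs at * <;> omega
  exact ⟨h.owner_eq_zero, h.price_le, h.adj_of_owner, h.slack, h.active,
    fun v hv hv' => by rw [ht v hv hv']; exact h.count_le v hv hv',
    fun v hv hv' => by rw [ht v hv hv']; exact h.count_or v hv hv'⟩

theorem issue (h : AuctionInv n adj hi price owner x 0) {u : ℕ} (hx : x < 2 * n)
    (hu : u = if x < n then x else x - n) (hh : ¬ hi u) :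
    AuctionInv n adj hi price owner (x + 1) (u + 1) := by
  have hun : u < n := by rw [hu]; split_ifs <;> omega
  have ht : ∀ v < n, tokenCount n (x + 1) v
      = tokenCount n x v + if u + 1 = v + 1 then 1 else 0 := by
    intro v hv
    unfold tokenCount
    split_ifs at * <;> omega
  refine ⟨h.owner_eq_zero, h.price_le, h.adj_of_owner, h.slack, fun v hv => ?_,
    fun v hv hv' => ?_, fun v hv hv' => ?_⟩
  · obtain rfl : u = v := by omega
    exact ⟨hun, hh⟩
  · have := h.count_le v hv hv'
    rw [ht v hv]
    simp at this ⊢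
    omega
  · rw [ht v hv]
    refine (h.count_or v hv hv').imp_left fun h1 => ?_
    simp at h1 ⊢
    omega

theorem quit {u : ℕ} (h : AuctionInv n adj hi price owner x (u + 1))
    (hu : ∀ d < n, hi d → adj u d → n + 2 ≤ price d) :
    AuctionInv n adj hi price owner x 0 := by
  refine ⟨h.owner_eq_zero, h.price_le, h.adj_of_owner, h.slack, fun v hv => by omega,
    fun v hv hv' => ?_, fun v hv hv' => ?_⟩
  · have := h.count_le v hv hv'
    simp at this ⊢
    omega
  · by_cases e : u = v
    · subst e
      exact Or.inr hu
    · refine (h.count_or v hv hv').imp_left fun h1 => ?_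
      simpa [e] using h1

theorem bid {u c : ℕ} (h : AuctionInv n adj hi price owner x (u + 1)) (hc : c < n) (hh : hi c)
    (ha : adj u c) (hp : price c < n + 2)
    (hmin : ∀ d < n, hi d → adj u d → price c ≤ price d) :
    AuctionInv n adj hi (Function.update price c (price c + 1))
      (Function.update owner c (u + 1)) x (owner c) := by
  obtain ⟨hun, huh⟩ := h.active u rfl
  have hle : ∀ d, price d ≤ Function.update price c (price c + 1) d := by
    intro d
    by_cases e : d = c
    · subst e; simp
    · rw [Function.update_of_ne e]
  refine ⟨fun d hd => ?_, fun d hd => ?_, fun d hd v hv => ?_, fun d hd v hv e he he' hve => ?_,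
    fun v hv => ?_, fun v hv hv' => ?_, fun v hv hv' => ?_⟩
  · by_cases e : d = c
    · subst e; simp
    · rw [Function.update_of_ne e, Function.update_of_ne e]
      exact h.owner_eq_zero d hd
  · by_cases e : d = c
    · subst e; rw [Function.update_self]; omega
    · rw [Function.update_of_ne e]
      exact h.price_le d hd
  · by_cases e : d = c
    · subst e
      rw [Function.update_self] at hv
      obtain rfl : u = v := by omega
      exact ⟨hun, huh, hh, ha⟩
    · rw [Function.update_of_ne e] at hv
      exact h.adj_of_owner d hd v hv
  · refine le_trans ?_ (Nat.add_le_add_right (hle e) 1)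
    by_cases e' : d = c
    · subst e'
      rw [Function.update_self] at hv ⊢
      obtain rfl : u = v := by omega
      exact Nat.add_le_add_right (hmin e he he' hve) 1
    · rw [Function.update_of_ne e'] at hv ⊢
      exact h.slack d hd v hv e he he' hve
  · exact ⟨(h.adj_of_owner c hc v hv).1, (h.adj_of_owner c hc v hv).2.1⟩
  · rw [card_filter_update hc]
    exact h.count_le v hv hv'
  · rw [card_filter_update hc]
    exact (h.count_or v hv hv').imp_right fun h1 d hd hd' hvd => (h1 d hd hd' hvd).trans (hle d)

open Classical in
theorem card_le (h : AuctionInv n adj hi price owner (2 * n) 0) :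
    ((Finset.range n).filter fun c => 0 < price c).card
      ≤ 2 * ((Finset.range n).filter fun v => ¬ hi v).card := by
  refine Finset.card_le_mul_card_image_of_maps_to (f := fun c => owner c - 1) (fun c hc => ?_) 2
    fun v hv => ?_
  · rw [Finset.mem_filter, Finset.mem_range] at hc ⊢
    have h0 : owner c ≠ 0 := fun e => by
      have := (h.owner_eq_zero c hc.1).1 e
      omega
    have := h.adj_of_owner c hc.1 (owner c - 1) (by omega)
    exact ⟨this.1, this.2.1⟩
  · rw [Finset.mem_filter, Finset.mem_range] at hv
    refine le_trans (Finset.card_le_card fun c hc => ?_)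
      ((Nat.le_add_right _ _).trans ((h.count_le v hv.1 hv.2).trans ?_))
    · simp only [Finset.mem_filter, Finset.mem_range] at hc ⊢
      have h0 : owner c ≠ 0 := fun e => by
        have := (h.owner_eq_zero c hc.1.1).1 e
        omega
      exact ⟨hc.1.1, by omega⟩
    · unfold tokenCount
      split_ifs <;> omega

/-- When the auction is over, a gap in the prices separates the contested vertices `Z` from the
others: a vertex either competes for vertices in `Z` only, or has bought two vertices outside of
`Z`. -/
theorem exists_gap (h : AuctionInv n adj hi price owner (2 * n) 0) :
    ∃ Z : Finset ℕ, (∀ c ∈ Z, c < n ∧ 0 < price c) ∧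
      ∀ v < n, ¬ hi v → (∀ d < n, hi d → adj v d → d ∈ Z) ∨
        ∃ c < n, ∃ d < n, c ≠ d ∧ c ∉ Z ∧ d ∉ Z ∧ owner c = v + 1 ∧ owner d = v + 1 := by
  obtain ⟨m, hm, hm'⟩ : ∃ m ∈ Finset.Icc 1 (n + 1), m ∉ (Finset.range n).image price := by
    by_contra! hno
    have h1 := Finset.card_le_card (s := Finset.Icc 1 (n + 1)) hno
    have h2 := (Finset.card_image_le (s := Finset.range n) (f := price))
    rw [Nat.card_Icc] at h1
    rw [Finset.card_range] at h2
    omega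
  have hgap : ∀ c < n, price c ≠ m := fun c hc e =>
    hm' (Finset.mem_image.2 ⟨c, Finset.mem_range.2 hc, e⟩)
  rw [Finset.mem_Icc] at hm
  refine ⟨(Finset.range n).filter fun c => m < price c, fun c hc => ?_, fun v hv hv' => ?_⟩
  · rw [Finset.mem_filter, Finset.mem_range] at hc
    exact ⟨hc.1, by omega⟩
  · by_cases hZ : ∀ d < n, hi d → adj v d → m < price d
    · exact Or.inl fun d hd hd' hvd => Finset.mem_filter.2 ⟨Finset.mem_range.2 hd, hZ d hd hd' hvd⟩
    right
    have hown : ∀ c < n, owner c = v + 1 → ¬ m < price c := fun c hc hcv hmc => by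
      refine hZ fun d hd hd' hvd => ?_
      have := h.slack c hc v hcv d hd hd' hvd
      have := hgap d hd
      omega
    have hcard : 1 < ((Finset.range n).filter fun c => owner c = v + 1).card := by
      rcases h.count_or v hv hv' with h1 | h1
      · have : tokenCount n (2 * n) v = 2 := by
          unfold tokenCount
          split_ifs <;> omega
        simp only [Nat.zero_ne_add_one, if_false, this] at h1
        omega
      · exact absurd (fun d hd hd' hvd => by have := h1 d hd hd' hvd; omega) hZ
    obtain ⟨c, hc, d, hd, hcd⟩ := Finset.one_lt_card.1 hcard
    simp only [Finset.mem_filter, Finset.mem_range] at hc hd ⊢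
    exact ⟨c, hc.1, d, hd.1, hcd, fun h => hown c hc.1 hc.2 h.2, fun h => hown d hd.1 hd.2 h.2,
      hc.2, hd.2⟩

end AuctionInv

namespace RAM

/-- With words below `W`, the program `p`, started in `s`, halts after at most `T` steps in a state
that satisfies `Q`. -/
def Run (W : ℕ) (p : Prog) (s : State) (T : ℕ) (Q : State → Prop) : Prop :=
  ∃ t s', Exec W p s t s' ∧ t ≤ T ∧ Q s'

/-- The state after writing `v` to register `r`. -/
def State.setReg (s : State) (r v : ℕ) : State := ⟨Function.update s.reg r v, s.mem⟩

/-- The state after writing `v` to the memory cell `a`. -/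
def State.setMem (s : State) (a v : ℕ) : State := ⟨s.reg, Function.update s.mem a v⟩

@[simp] theorem State.setReg_reg (s : State) (r v r' : ℕ) :
    (s.setReg r v).reg r' = if r' = r then v else s.reg r' := Function.update_apply ..

@[simp] theorem State.setReg_mem (s : State) (r v : ℕ) : (s.setReg r v).mem = s.mem := rfl

@[simp] theorem State.setMem_reg (s : State) (a v : ℕ) : (s.setMem a v).reg = s.reg := rfl

@[simp] theorem State.setMem_mem (s : State) (a v : ℕ) :
    (s.setMem a v).mem = Function.update s.mem a v := rfl

/-- An upper bound on the running time of a program without loops. -/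
def Prog.size : Prog → ℕ
  | .skip => 1
  | .assign _ e => e.cost + 1
  | .store a e => a.cost + e.cost + 1
  | .seq p q => p.size + q.size
  | .branch e p q => e.cost + 1 + (p.size + q.size)
  | .loop _ _ => 0

/-- The weakest precondition of a program without loops. -/
def Prog.wp (W : ℕ) : Prog → (State → Prop) → State → Prop
  | .skip, Q, s => Q s
  | .assign r e, Q, s => e.Fits W s ∧ Q (s.setReg r (e.val s))
  | .store a e, Q, s => a.Fits W s ∧ e.Fits W s ∧ Q (s.setMem (a.val s) (e.val s))
  | .seq p q, Q, s => p.wp W (q.wp W Q) s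
  | .branch e p q, Q, s =>
    e.Fits W s ∧ (e.val s ≠ 0 → p.wp W Q s) ∧ (e.val s = 0 → q.wp W Q s)
  | .loop _ _, _, _ => False

theorem run_of_wp {W : ℕ} {p : Prog} {s : State} {Q : State → Prop} (h : p.wp W Q s) :
    Run W p s p.size Q := by
  induction p generalizing s Q with
  | skip => exact ⟨_, _, .skip s, le_rfl, h⟩
  | assign r e => exact ⟨_, _, .assign s r e h.1, le_rfl, h.2⟩
  | store a e => exact ⟨_, _, .store s a e h.1 h.2.1, le_rfl, h.2.2⟩
  | seq p q ihp ihq =>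
    obtain ⟨t, s', h1, h2, h3⟩ := ihp h
    obtain ⟨t', s'', h1', h2', h3'⟩ := ihq h3
    exact ⟨_, _, .seq h1 h1', Nat.add_le_add h2 h2', h3'⟩
  | branch e p q ihp ihq =>
    by_cases hv : e.val s = 0
    · obtain ⟨t, s', h1, h2, h3⟩ := ihq (h.2.2 hv)
      refine ⟨_, _, .branch_false h.1 hv h1, ?_, h3⟩
      simp only [Prog.size]
      omega
    · obtain ⟨t, s', h1, h2, h3⟩ := ihp (h.2.1 hv)
      refine ⟨_, _, .branch_true h.1 hv h1, ?_, h3⟩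
      simp only [Prog.size]
      omega
  | loop => exact h.elim

variable {W T T' : ℕ} {p q : Prog} {e : Expr} {s : State} {Q R : State → Prop}

theorem Run.of_wp (h : p.wp W Q s) (hT : p.size ≤ T) : Run W p s T Q :=
  let ⟨t, s', h1, h2, h3⟩ := run_of_wp h
  ⟨t, s', h1, h2.trans hT, h3⟩

theorem Run.mono (h : Run W p s T Q) (hT : T ≤ T') (hQ : ∀ s, Q s → R s) : Run W p s T' R :=
  let ⟨t, s', h1, h2, h3⟩ := h
  ⟨t, s', h1, h2.trans hT, hQ _ h3⟩

theorem Run.seq (h : Run W p s T Q) (h' : ∀ s, Q s → Run W q s T' R) :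
    Run W (.seq p q) s (T + T') R :=
  let ⟨_, _, h1, h2, h3⟩ := h
  let ⟨_, _, h1', h2', h3'⟩ := h' _ h3
  ⟨_, _, .seq h1 h1', Nat.add_le_add h2 h2', h3'⟩

theorem Run.branch (hf : e.Fits W s) (hp : e.val s ≠ 0 → Run W p s T Q)
    (hq : e.val s = 0 → Run W q s T Q) : Run W (.branch e p q) s (e.cost + 1 + T) Q := by
  by_cases hv : e.val s = 0
  · obtain ⟨t, s', h1, h2, h3⟩ := hq hv
    exact ⟨_, _, .branch_false hf hv h1, by omega, h3⟩
  · obtain ⟨t, s', h1, h2, h3⟩ := hp hv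
    exact ⟨_, _, .branch_true hf hv h1, by omega, h3⟩

/-- Total correctness of a loop with an invariant `I` that is indexed by a bound on the number of
remaining iterations. -/
theorem Run.loop {I : ℕ → State → Prop} (hf : ∀ k s, I k s → e.Fits W s)
    (hstep : ∀ k s, I k s → e.val s ≠ 0 → ∃ k', k = k' + 1 ∧ Run W p s T (I k'))
    {k : ℕ} (hI : I k s) :
    Run W (.loop e p) s ((k + 1) * (T + e.cost + 1)) fun s => e.val s = 0 ∧ ∃ k, I k s := by
  induction k generalizing s with
  | zero =>
    by_cases hv : e.val s = 0
    · exact ⟨_, _, .loop_false (hf _ _ hI) hv, by omega, hv, _, hI⟩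
    · obtain ⟨k', hk, -⟩ := hstep _ _ hI hv
      omega
  | succ k ih =>
    by_cases hv : e.val s = 0
    · refine ⟨_, _, .loop_false (hf _ _ hI) hv, ?_, hv, _, hI⟩
      rw [Nat.succ_mul]
      omega
    · obtain ⟨k', hk, t, s', h1, h2, h3⟩ := hstep _ _ hI hv
      obtain rfl : k = k' := by omega
      obtain ⟨t', s'', h1', h2', h3'⟩ := ih h3
      refine ⟨_, _, .loop_true (hf _ _ hI) hv h1 h1', ?_, h3'⟩
      rw [Nat.succ_mul (k + 1)]
      omega

/-- The program that runs `p` with register `r` set to `0, 1, …` as long as the content of `r` is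
less than that of register `b`. -/
def Prog.forLoop (r b : ℕ) (p : Prog) : Prog :=
  .seq (.assign r (.const 0))
    (.loop (.sub (.reg b) (.reg r)) (.seq p (.assign r (.add (.reg r) (.const 1)))))

theorem Run.forLoop {r b N : ℕ} (hN : N + 1 < W) (I : ℕ → State → Prop)
    (hI : ∀ i s, I i s → s.reg r = i ∧ s.reg b = N) (h0 : I 0 (s.setReg r 0))
    (hstep : ∀ i s, i < N → I i s →
      Run W p s T fun s' => s'.reg r = i ∧ I (i + 1) (s'.setReg r (i + 1))) :
    Run W (.forLoop r b p) s ((N + 1) * (T + 10)) (I N) := by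
  have h1 : Run W (.assign r (.const 0)) s 2 (I 0) :=
    Run.of_wp ⟨by simp only [Expr.Fits]; omega, h0⟩ le_rfl
  have h2 : ∀ s, I 0 s → Run W (.loop (.sub (.reg b) (.reg r))
      (.seq p (.assign r (.add (.reg r) (.const 1))))) s ((N + 1) * ((T + 4) + 3 + 1)) (I N) := by
    intro s hs
    refine (Run.loop (I := fun k s => ∃ i, i + k = N ∧ I i s) (k := N) ?_ ?_
      ⟨0, by omega, hs⟩).mono le_rfl ?_
    · rintro k s ⟨i, hik, hi⟩
      obtain ⟨e1, e2⟩ := hI i s hi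
      simp only [Expr.Fits, e1, e2]
      omega
    · rintro k s ⟨i, hik, hi⟩ hv
      obtain ⟨e1, e2⟩ := hI i s hi
      simp only [Expr.val, e1, e2] at hv
      refine ⟨k - 1, by omega, (hstep i s (by omega) hi).seq fun s' ⟨h3, h4⟩ => Run.of_wp ?_ le_rfl⟩
      simp only [Prog.wp, Expr.Fits, Expr.val, h3]
      exact ⟨by omega, i + 1, by omega, h4⟩
    · rintro s ⟨hv, k, i, hik, hi⟩
      obtain ⟨e1, e2⟩ := hI i s hi
      simp only [Expr.val, e1, e2] at hv
      obtain rfl : i = N := by omega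
      exact hi
  refine (h1.seq h2).mono ?_ fun _ h => h
  have : (N + 1) * (T + 10) = (N + 1) * ((T + 4) + 3 + 1) + (N + 1) * 2 := by ring
  omega

end RAM

namespace RAM

theorem mul_add_le_mul {i m n : ℕ} (h : i < m) : i * n + n ≤ m * n := by
  have := Nat.mul_le_mul_right n h
  rwa [Nat.succ_mul] at this

/-- The memory contains, one after the other, an `n × n` matrix `A` and arrays `H`, `P` and `O` of
length `n`. -/
structure Layout (n : ℕ) (A : ℕ → ℕ → ℕ) (H P O : ℕ → ℕ) (m : ℕ → ℕ) : Prop where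
  adj : ∀ i < n, ∀ j < n, m (i * n + j) = A i j
  hi : ∀ i < n, m (n * n + i) = H i
  price : ∀ i < n, m (n * n + n + i) = P i
  owner : ∀ i < n, m (n * n + 2 * n + i) = O i

namespace Layout

variable {n : ℕ} {A : ℕ → ℕ → ℕ} {H P O m : ℕ → ℕ}

theorem update_hi (h : Layout n A H P O m) {i : ℕ} (hi : i < n) (v : ℕ) :
    Layout n A (Function.update H i v) P O (Function.update m (n * n + i) v) := by
  refine ⟨fun a ha b hb => ?_, fun a ha => ?_, fun a ha => ?_, fun a ha => ?_⟩
  · have := mul_add_le_mul (n := n) ha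
    rw [Function.update_of_ne (by omega)]
    exact h.adj a ha b hb
  · by_cases e : a = i
    · subst e; simp
    · rw [Function.update_of_ne e, Function.update_of_ne (by omega)]
      exact h.hi a ha
  · rw [Function.update_of_ne (by omega)]
    exact h.price a ha
  · rw [Function.update_of_ne (by omega)]
    exact h.owner a ha

theorem update_price (h : Layout n A H P O m) {i : ℕ} (hi : i < n) (v : ℕ) :
    Layout n A H (Function.update P i v) O (Function.update m (n * n + n + i) v) := by
  refine ⟨fun a ha b hb => ?_, fun a ha => ?_, fun a ha => ?_, fun a ha => ?_⟩
  · have := mul_add_le_mul (n := n) ha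
    rw [Function.update_of_ne (by omega)]
    exact h.adj a ha b hb
  · rw [Function.update_of_ne (by omega)]
    exact h.hi a ha
  · by_cases e : a = i
    · subst e; simp
    · rw [Function.update_of_ne e, Function.update_of_ne (by omega)]
      exact h.price a ha
  · rw [Function.update_of_ne (by omega)]
    exact h.owner a ha

theorem update_owner (h : Layout n A H P O m) {i : ℕ} (hi : i < n) (v : ℕ) :
    Layout n A H P (Function.update O i v) (Function.update m (n * n + 2 * n + i) v) := by
  refine ⟨fun a ha b hb => ?_, fun a ha => ?_, fun a ha => ?_, fun a ha => ?_⟩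
  · have := mul_add_le_mul (n := n) ha
    rw [Function.update_of_ne (by omega)]
    exact h.adj a ha b hb
  · rw [Function.update_of_ne (by omega)]
    exact h.hi a ha
  · rw [Function.update_of_ne (by omega)]
    exact h.price a ha
  · by_cases e : a = i
    · subst e; simp
    · rw [Function.update_of_ne e, Function.update_of_ne (by omega)]
      exact h.owner a ha

theorem update_of_le (h : Layout n A H P O m) {a : ℕ} (ha : n * n + 3 * n ≤ a) (v : ℕ) :
    Layout n A H P O (Function.update m a v) := by
  refine ⟨fun i hi j hj => ?_, fun i hi => ?_, fun i hi => ?_, fun i hi => ?_⟩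
  · have := mul_add_le_mul (n := n) hi
    rw [Function.update_of_ne (by omega)]
    exact h.adj i hi j hj
  · rw [Function.update_of_ne (by omega)]
    exact h.hi i hi
  · rw [Function.update_of_ne (by omega)]
    exact h.price i hi
  · rw [Function.update_of_ne (by omega)]
    exact h.owner i hi

end Layout

/-- Register `0` contains `n`, register `1` contains `0`, and the registers `3, …, 7` contain the
addresses of the arrays that follow the input. -/
structure Regs (n : ℕ) (s : State) : Prop where
  r0 : s.reg 0 = n
  r1 : s.reg 1 = 0
  r3 : s.reg 3 = n * n
  r4 : s.reg 4 = n * n + n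
  r5 : s.reg 5 = n * n + 2 * n
  r6 : s.reg 6 = n * n + 3 * n
  r7 : s.reg 7 = n * n + 4 * n

theorem Regs.congr {n : ℕ} {s s' : State} (h : Regs n s) (hs : ∀ r < 8, s'.reg r = s.reg r) :
    Regs n s' := by
  constructor <;> rw [hs _ (by norm_num)]
  exacts [h.r0, h.r1, h.r3, h.r4, h.r5, h.r6, h.r7]

theorem Regs.setReg {n : ℕ} {s : State} (h : Regs n s) {r : ℕ} (hr : 8 ≤ r) (v : ℕ) :
    Regs n (s.setReg r v) :=
  h.congr fun r' hr' => by rw [State.setReg_reg, if_neg (by omega)]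

theorem Regs.setMem {n : ℕ} {s : State} (h : Regs n s) (a v : ℕ) : Regs n (s.setMem a v) :=
  h.congr fun _ _ => rfl

/-- Compute the addresses of the arrays. -/
def setup : Prog :=
  .seq (.assign 3 (.mul (.reg 0) (.reg 0))) <|
  .seq (.assign 4 (.add (.reg 3) (.reg 0))) <|
  .seq (.assign 5 (.add (.reg 4) (.reg 0))) <|
  .seq (.assign 6 (.add (.reg 5) (.reg 0))) (.assign 7 (.add (.reg 6) (.reg 0)))

/-- Register `12` becomes the sum of the row of the matrix given by register `10`. -/
def rowSum : Prog :=
  .seq (.assign 12 (.const 0)) <| .forLoop 11 0 <|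
    .assign 12 (.add (.reg 12) (.load (.add (.mul (.reg 10) (.reg 0)) (.reg 11))))

/-- For each vertex, store whether its degree is at least `n / 2`, and let register `8` be the
number of vertices for which this is not so. -/
def classify : Prog :=
  .seq (.assign 8 (.const 0)) <| .forLoop 10 0 <| .seq rowSum <|
    .seq (.assign 13 (.sub (.const 1) (.sub (.reg 0) (.add (.reg 12) (.reg 12))))) <|
    .seq (.store (.add (.reg 3) (.reg 10)) (.reg 13))
      (.assign 8 (.add (.reg 8) (.sub (.const 1) (.reg 13))))

variable {n W : ℕ} {A : ℕ → ℕ → ℕ} {H P O : ℕ → ℕ} {s : State}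

theorem run_setup (hW : 100 * (n * n) + 100 * n + 1000 ≤ W) (h0 : s.reg 0 = n) (h1 : s.reg 1 = 0) :
    Run W setup s 20 fun s' => s'.mem = s.mem ∧ Regs n s' := by
  refine Run.of_wp ?_ (by decide)
  simp only [setup, Prog.wp, Expr.Fits, Expr.val, State.setReg_reg, State.setReg_mem]
  norm_num [h0]
  refine ⟨by omega, by omega, by omega, by omega, by omega, ?_⟩
  constructor <;> simp [h0, h1] <;> omega

theorem run_rowSum (hW : 100 * (n * n) + 100 * n + 1000 ≤ W) (hs : Regs n s)
    (hL : Layout n A H P O s.mem) (hA : ∀ i j, A i j ≤ 1) {i : ℕ} (hi : i < n)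
    (hsi : s.reg 10 = i) :
    Run W rowSum s ((n + 1) * 30) fun s' => s'.mem = s.mem ∧
      (∀ r, r ≠ 11 → r ≠ 12 → s'.reg r = s.reg r) ∧
      s'.reg 12 = ∑ j ∈ Finset.range n, A i j := by
  have hin := mul_add_le_mul (n := n) hi
  have hsum : ∀ j, ∑ j ∈ Finset.range j, A i j ≤ j := fun j =>
    (Finset.sum_le_card_nsmul _ _ 1 fun k _ => hA i k).trans (by simp)
  refine ((Run.of_wp (T := 2) (Q := fun s' => s' = s.setReg 12 0) ?_ (by decide)).seq
    (T' := (n + 1) * (10 + 10)) (R := fun s' => s'.mem = s.mem ∧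
      (∀ r, r ≠ 11 → r ≠ 12 → s'.reg r = s.reg r) ∧
      s'.reg 12 = ∑ j ∈ Finset.range n, A i j) ?_).mono ?_ fun _ h => h
  · simp [Prog.wp, Expr.Fits, Expr.val]
    omega
  · rintro _ rfl
    refine (Run.forLoop (by omega) (fun j s' => s'.mem = s.mem ∧
      (∀ r, r ≠ 11 → r ≠ 12 → s'.reg r = s.reg r) ∧ s'.reg 11 = j ∧
      s'.reg 12 = ∑ j ∈ Finset.range j, A i j) ?_ ?_ ?_).mono le_rfl ?_
    · rintro j s' ⟨-, h1, h2, -⟩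
      exact ⟨h2, (h1 0 (by norm_num) (by norm_num)).trans hs.r0⟩
    · refine ⟨rfl, fun r h1 h2 => ?_, ?_, ?_⟩ <;> simp [*]
    · rintro j s' hj ⟨h1, h2, h3, h4⟩
      refine Run.of_wp ?_ (by decide)
      have e0 : s'.reg 0 = n := (h2 0 (by norm_num) (by norm_num)).trans hs.r0
      have e10 : s'.reg 10 = i := (h2 10 (by norm_num) (by norm_num)).trans hsi
      have := hsum j
      have := hA i j
      have e : s'.mem (i * n + j) = A i j := by rw [h1, hL.adj i hi j hj]
      simp only [Prog.wp, Expr.Fits, Expr.val, e0, e10, h3, h4, e]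
      refine ⟨by omega, by simp [h3], h1, fun r a b => ?_, by simp, ?_⟩
      · simp [a, b, h2]
      · simp [Finset.sum_range_succ]
    · rintro s' ⟨h1, h2, -, h4⟩
      exact ⟨h1, h2, h4⟩
  · omega

/-- The entry of the array `H` for a row with the sum `d`: `1` if `n ≤ 2 * d`, and else `0`. -/
def hiFlag (n d : ℕ) : ℕ := 1 - (n - (d + d))

theorem hiFlag_le (n d : ℕ) : hiFlag n d ≤ 1 := Nat.sub_le _ _

theorem run_classify (hW : 100 * (n * n) + 100 * n + 1000 ≤ W) (hs : Regs n s)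
    (hL : Layout n A (fun _ => 0) P O s.mem) (hA : ∀ i j, A i j ≤ 1) :
    Run W classify s ((n + 1) * (n + 1) * 70) fun s' => Regs n s' ∧
      ∃ H, Layout n A H P O s'.mem ∧ (∀ i, H i ≤ 1) ∧
      (∀ i < n, H i = hiFlag n (∑ j ∈ Finset.range n, A i j)) ∧
      s'.reg 8 = ∑ i ∈ Finset.range n, (1 - H i) := by
  refine ((Run.of_wp (T := 2) (Q := fun s' => s' = s.setReg 8 0) ?_ (by decide)).seq
    (T' := (n + 1) * ((n + 1) * 30 + 22 + 10)) (R := fun s' => Regs n s' ∧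
      ∃ H, Layout n A H P O s'.mem ∧ (∀ i, H i ≤ 1) ∧
      (∀ i < n, H i = hiFlag n (∑ j ∈ Finset.range n, A i j)) ∧
      s'.reg 8 = ∑ i ∈ Finset.range n, (1 - H i)) ?_).mono ?_ fun _ h => h
  · simp [Prog.wp, Expr.Fits, Expr.val]
    omega
  · rintro _ rfl
    refine (Run.forLoop (by omega) (fun i s' => Regs n s' ∧ s'.reg 10 = i ∧
      ∃ H, Layout n A H P O s'.mem ∧ (∀ i, H i ≤ 1) ∧
      (∀ j < i, H j = hiFlag n (∑ j' ∈ Finset.range n, A j j')) ∧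
      s'.reg 8 = ∑ j ∈ Finset.range i, (1 - H j)) ?_ ?_ ?_).mono le_rfl ?_
    · rintro i s' ⟨h1, h2, -⟩
      exact ⟨h2, h1.r0⟩
    · exact ⟨(hs.setReg le_rfl _).setReg (by norm_num) _, by simp, fun _ => 0, hL, by simp, by simp,
        by simp⟩
    · rintro i s' hi ⟨h1, h2, H, h3, h4, h5, h6⟩
      refine (run_rowSum hW h1 h3 hA hi h2).seq (T' := 22) fun s'' ⟨g1, g2, g3⟩ =>
        Run.of_wp ?_ (by decide)
      have hr : Regs n s'' := h1.congr fun r hr => g2 r (by omega) (by omega)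
      have e10 : s''.reg 10 = i := (g2 10 (by norm_num) (by norm_num)).trans h2
      have e8 := (g2 8 (by norm_num) (by norm_num)).trans h6
      set d := ∑ j ∈ Finset.range n, A i j with hd
      have hdn : d ≤ n := (Finset.sum_le_card_nsmul _ _ 1 fun k _ => hA i k).trans (by simp)
      have hcn : ∑ j ∈ Finset.range i, (1 - H j) ≤ i :=
        (Finset.sum_le_card_nsmul _ _ 1 fun k _ => Nat.sub_le _ _).trans (by simp)
      simp [Prog.wp, Expr.Fits, Expr.val, hr.r0, hr.r3, e10, e8, g3]
      refine ⟨by omega, by omega, by omega, by omega,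
        (((hr.setReg (by norm_num) _).setMem _ _).setReg (by norm_num) _).setReg (by norm_num) _,
        Function.update H i (hiFlag n d), ?_, fun j => ?_, fun j hj => ?_, ?_⟩
      · rw [g1]
        exact h3.update_hi hi _
      · by_cases e : j = i
        · subst e; simp [hiFlag_le]
        · rw [Function.update_of_ne e]; exact h4 j
      · by_cases e : j = i
        · subst e; simp [hd]
        · rw [Function.update_of_ne e]; exact h5 j (by omega)
      · rw [Finset.sum_range_succ, Function.update_self, hiFlag]
        congr 1
        exact Finset.sum_congr rfl fun j hj => by
          rw [Function.update_of_ne (Finset.mem_range.1 hj).ne]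
    · rintro s' ⟨h1, -, h3⟩
      exact ⟨h1, h3⟩
  · nlinarith

end RAM

namespace RAM

/-- Given a vertex `u` with `u + 1` in register `21`, find a neighbour of `u` of large degree that
has the least price, unless all prices are at least `n + 2`. Registers `22` and `23` become the
neighbour and its price. -/
def pickBest : Prog :=
  .seq (.seq (.assign 24 (.sub (.reg 21) (.const 1))) <|
    .seq (.assign 22 (.const 0)) (.assign 23 (.add (.reg 0) (.const 2)))) <|
  .forLoop 11 0 <|
    .branch (.mul (.load (.add (.mul (.reg 24) (.reg 0)) (.reg 11)))
        (.mul (.load (.add (.reg 3) (.reg 11))) (.sub (.reg 23) (.load (.add (.reg 4) (.reg 11))))))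
      (.seq (.assign 22 (.reg 11)) (.assign 23 (.load (.add (.reg 4) (.reg 11)))))
      .skip

/-- Let the active vertex bid. -/
def bidStep : Prog :=
  .seq pickBest <|
    .branch (.sub (.add (.reg 0) (.const 2)) (.reg 23))
      (.seq (.store (.add (.reg 4) (.reg 22)) (.add (.reg 23) (.const 1))) <|
        .seq (.assign 25 (.load (.add (.reg 5) (.reg 22)))) <|
        .seq (.store (.add (.reg 5) (.reg 22)) (.reg 21)) (.assign 21 (.reg 25)))
      (.assign 21 (.const 0))

/-- Issue the next token. -/
def issueStep : Prog :=
  .seq (.branch (.sub (.reg 0) (.reg 20)) (.assign 24 (.reg 20))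
      (.assign 24 (.sub (.reg 20) (.reg 0)))) <|
  .seq (.branch (.load (.add (.reg 3) (.reg 24))) .skip
      (.assign 21 (.add (.reg 24) (.const 1))))
    (.assign 20 (.add (.reg 20) (.const 1)))

def auction : Prog :=
  .seq (.seq (.assign 20 (.const 0)) (.assign 21 (.const 0))) <|
    .loop (.add (.sub (.add (.reg 0) (.reg 0)) (.reg 20)) (.reg 21))
      (.branch (.reg 21) bidStep issueStep)

variable {n W M : ℕ} {A : ℕ → ℕ → ℕ} {H P O : ℕ → ℕ} {s : State}

theorem run_pickBest (hW : 100 * (n * n) + 100 * n + 1000 ≤ W) (hs : Regs n s)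
    (hL : Layout n A H P O s.mem) (hA : ∀ i j, A i j ≤ 1) (hH : ∀ i, H i ≤ 1)
    (hP : ∀ c < n, P c ≤ n + 2) {u : ℕ} (hu : u < n) (hsu : s.reg 21 = u + 1) :
    Run W pickBest s ((n + 1) * 60) fun s' => s'.mem = s.mem ∧
      (∀ r, r ≠ 11 → r ≠ 22 → r ≠ 23 → r ≠ 24 → s'.reg r = s.reg r) ∧
      (∀ d < n, H d ≠ 0 → A u d ≠ 0 → s'.reg 23 ≤ P d) ∧ s'.reg 23 ≤ n + 2 ∧
      (s'.reg 23 < n + 2 → s'.reg 22 < n ∧ H (s'.reg 22) ≠ 0 ∧ A u (s'.reg 22) ≠ 0 ∧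
        P (s'.reg 22) = s'.reg 23) := by
  have hun := mul_add_le_mul (n := n) hu
  refine ((Run.of_wp (T := 10) (Q := fun s' => s' =
    ((s.setReg 24 u).setReg 22 0).setReg 23 (n + 2)) ?_ (by decide)).seq
    (T' := (n + 1) * (40 + 10)) (R := fun s' => s'.mem = s.mem ∧
      (∀ r, r ≠ 11 → r ≠ 22 → r ≠ 23 → r ≠ 24 → s'.reg r = s.reg r) ∧
      (∀ d < n, H d ≠ 0 → A u d ≠ 0 → s'.reg 23 ≤ P d) ∧ s'.reg 23 ≤ n + 2 ∧
      (s'.reg 23 < n + 2 → s'.reg 22 < n ∧ H (s'.reg 22) ≠ 0 ∧ A u (s'.reg 22) ≠ 0 ∧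
        P (s'.reg 22) = s'.reg 23)) ?_).mono ?_ fun _ h => h
  · simp [Prog.wp, Expr.Fits, Expr.val, hsu, hs.r0]
    omega
  · rintro _ rfl
    refine (Run.forLoop (by omega) (fun j s' => s'.mem = s.mem ∧
      (∀ r, r ≠ 11 → r ≠ 22 → r ≠ 23 → r ≠ 24 → s'.reg r = s.reg r) ∧ s'.reg 11 = j ∧
      s'.reg 24 = u ∧
      (∀ d < j, H d ≠ 0 → A u d ≠ 0 → s'.reg 23 ≤ P d) ∧ s'.reg 23 ≤ n + 2 ∧
      (s'.reg 23 < n + 2 → s'.reg 22 < n ∧ H (s'.reg 22) ≠ 0 ∧ A u (s'.reg 22) ≠ 0 ∧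
        P (s'.reg 22) = s'.reg 23)) ?_ ?_ ?_).mono le_rfl ?_
    · rintro j s' ⟨-, h1, h2, -⟩
      exact ⟨h2, (h1 0 (by norm_num) (by norm_num) (by norm_num) (by norm_num)).trans hs.r0⟩
    · refine ⟨rfl, fun r h1 h2 h3 h4 => ?_, ?_⟩ <;> simp [*]
    · rintro j s' hj ⟨h1, h2, h3, h4, h5, h6, h7⟩
      refine Run.of_wp ?_ (by decide)
      have e0 : s'.reg 0 = n :=
        (h2 0 (by norm_num) (by norm_num) (by norm_num) (by norm_num)).trans hs.r0
      have e3 : s'.reg 3 = n * n :=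
        (h2 3 (by norm_num) (by norm_num) (by norm_num) (by norm_num)).trans hs.r3
      have e4 : s'.reg 4 = n * n + n :=
        (h2 4 (by norm_num) (by norm_num) (by norm_num) (by norm_num)).trans hs.r4
      have m1 : s'.mem (u * n + j) = A u j := by rw [h1, hL.adj u hu j hj]
      have m2 : s'.mem (n * n + j) = H j := by rw [h1, hL.hi j hj]
      have m3 : s'.mem (n * n + n + j) = P j := by rw [h1, hL.price j hj]
      have hAj := hA u j
      have hHj := hH j
      have hPj := hP j hj
      have b1 : H j * (s'.reg 23 - P j) ≤ n + 2 :=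
        (Nat.mul_le_mul hHj (Nat.sub_le_of_le_add (by omega : s'.reg 23 ≤ n + 2 + P j))).trans
          (by omega)
      have b2 : A u j * (H j * (s'.reg 23 - P j)) ≤ n + 2 :=
        (Nat.mul_le_mul hAj b1).trans (by omega)
      simp only [Prog.wp, Expr.Fits, Expr.val, e0, e3, e4, h3, h4, m1, m2, m3, State.setReg_reg,
        State.setReg_mem]
      refine ⟨by omega, fun hv => ?_, fun hv => ?_⟩
      · have hv' : A u j ≠ 0 ∧ H j ≠ 0 ∧ s'.reg 23 - P j ≠ 0 := by
          simpa [not_or] using hv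
        obtain ⟨v1, v2, v3⟩ := hv'
        simp [m3]
        refine ⟨by omega, by omega, h1, fun r a1 a2 a3 a4 => ?_, fun d hd hd1 hd2 => ?_, by omega,
          fun _ => ⟨hj, v2, v1⟩⟩
        · simp [a1, a2, a3, h2 r a1 a2 a3 a4]
        · by_cases e : d = j
          · rw [e]
          · have := h5 d (by omega) hd1 hd2
            omega
      · refine ⟨trivial, h1, fun r a1 a2 a3 a4 => ?_, by simp, by simp,
          fun d hd hd1 hd2 => ?_, h6, h7⟩
        · simp [a1, h2 r a1 a2 a3 a4]
        · by_cases e : d = j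
          · subst e
            simp only [Nat.mul_eq_zero, hd1, hd2, false_or] at hv
            simp only [Nat.reduceEqDiff, if_false]
            omega
          · exact h5 d (by omega) hd1 hd2
    · rintro s' ⟨h1, h2, -, -, h5⟩
      exact ⟨h1, h2, h5⟩
  · omega

/-- The states that occur during the auction, when at most `k` steps remain. -/
def AuctionState (n M : ℕ) (A : ℕ → ℕ → ℕ) (H : ℕ → ℕ) (k : ℕ) (s : State) : Prop :=
  Regs n s ∧ s.reg 9 = M ∧ ∃ P O, Layout n A H P O s.mem ∧
    AuctionInv n (fun i j => A i j ≠ 0) (fun i => H i ≠ 0) P O (s.reg 20) (s.reg 21) ∧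
    s.reg 20 ≤ 2 * n ∧
    2 * (2 * n - s.reg 20) + auctionSlack n P + (if s.reg 21 = 0 then 0 else 1) ≤ k

theorem run_bidStep (hW : 100 * (n * n) + 100 * n + 1000 ≤ W) (hA : ∀ i j, A i j ≤ 1)
    (hH : ∀ i, H i ≤ 1) {k : ℕ} (hs : AuctionState n M A H (k + 1) s) (hy : s.reg 21 ≠ 0) :
    Run W bidStep s ((n + 1) * 60 + 40) (AuctionState n M A H k) := by
  obtain ⟨hr, h9, P, O, hL, hI, hx, hk⟩ := hs
  obtain ⟨u, hu⟩ : ∃ u, s.reg 21 = u + 1 := ⟨s.reg 21 - 1, by omega⟩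
  rw [hu] at hI
  obtain ⟨hun, -⟩ := hI.active u rfl
  refine (run_pickBest hW hr hL hA hH hI.price_le hun hu).seq
    fun s' ⟨g1, g2, g3, g4, g5⟩ => Run.of_wp ?_ (by decide)
  have hr' : Regs n s' := hr.congr fun r _ => g2 r (by omega) (by omega) (by omega) (by omega)
  have e9 : s'.reg 9 = M := (g2 9 (by norm_num) (by norm_num) (by norm_num) (by norm_num)).trans h9
  have e20 := g2 20 (by norm_num) (by norm_num) (by norm_num) (by norm_num)
  have e21 := (g2 21 (by norm_num) (by norm_num) (by norm_num) (by norm_num)).trans hu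
  simp only [hu, Nat.add_eq_zero_iff, one_ne_zero, and_false, if_false] at hk
  simp only [Prog.wp, Expr.Fits, Expr.val, hr'.r0]
  refine ⟨by omega, fun hv => ?_, fun hv => ?_⟩
  · obtain ⟨hb, hHb, hAb, hPb⟩ := g5 (by omega)
    have hmem : s'.mem (n * n + 2 * n + s'.reg 22) = O (s'.reg 22) := by
      rw [g1, hL.owner _ hb]
    have hO : O (s'.reg 22) ≤ n := by
      rcases Nat.eq_zero_or_pos (O (s'.reg 22)) with h | h
      · omega
      · have := (hI.adj_of_owner _ hb (O (s'.reg 22) - 1) (by omega)).1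
        omega
    have hne : Function.update s'.mem (n * n + n + s'.reg 22) (s'.reg 23 + 1)
        (n * n + 2 * n + s'.reg 22) = O (s'.reg 22) := by
      rw [Function.update_of_ne (by omega), hmem]
    simp [hr'.r4, hr'.r5, e21, hne]
    refine ⟨by omega, by omega, by omega, by omega, by omega, by omega, ?_, ?_, ?_⟩
    · exact (((hr'.setMem _ _).setReg (by norm_num) _).setMem _ _).setReg (by norm_num) _
    · simpa using e9
    · refine ⟨Function.update P (s'.reg 22) (P (s'.reg 22) + 1),
        Function.update O (s'.reg 22) (u + 1), ?_, ?_, ?_, ?_⟩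
      · simp only [State.setReg_mem, State.setMem_mem]
        rw [g1, ← hPb]
        exact (hL.update_price hb _).update_owner hb _
      · simp [e20]
        exact hI.bid hb hHb hAb (by omega) fun d hd h1 h2 => hPb ▸ g3 d hd h1 h2
      · simp [e20, hx]
      · have := auctionSlack_update hb (price := P) (by omega)
        simp [e20]
        split_ifs <;> omega
  · refine ⟨by omega, ?_, ?_, ?_⟩
    · exact hr'.setReg (by norm_num) _
    · simpa using e9
    · refine ⟨P, O, by simpa [g1] using hL, ?_, ?_, ?_⟩
      · simp [e20]
        exact hI.quit fun d hd h1 h2 => by have := g3 d hd h1 h2; omega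
      · simp [e20, hx]
      · simp [e20]
        omega

theorem run_issueStep (hW : 100 * (n * n) + 100 * n + 1000 ≤ W)
    (hH : ∀ i, H i ≤ 1) {k : ℕ} (hs : AuctionState n M A H (k + 1) s) (hy : s.reg 21 = 0)
    (hx' : s.reg 20 < 2 * n) :
    Run W issueStep s ((n + 1) * 60 + 40) (AuctionState n M A H k) := by
  obtain ⟨hr, h9, P, O, hL, hI, hx, hk⟩ := hs
  rw [hy] at hI
  simp only [hy, if_true] at hk
  obtain ⟨u, hu⟩ : ∃ u, u = if s.reg 20 < n then s.reg 20 else s.reg 20 - n := ⟨_, rfl⟩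
  have hun : u < n := by rw [hu]; split_ifs <;> omega
  have hfin : Prog.wp W (.seq (.branch (.load (.add (.reg 3) (.reg 24))) .skip
      (.assign 21 (.add (.reg 24) (.const 1))))
    (.assign 20 (.add (.reg 20) (.const 1)))) (AuctionState n M A H k) (s.setReg 24 u) := by
    have hm : s.mem (n * n + u) = H u := hL.hi u hun
    have := hH u
    simp [Prog.wp, Expr.Fits, Expr.val, hr.r3, hm]
    refine ⟨by omega, fun hv => ⟨by omega, ?_⟩, fun hv => ⟨by omega, by omega, ?_⟩⟩
    · refine ⟨(hr.setReg (by norm_num) _).setReg (by norm_num) _, by simpa using h9, P, O,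
        by simpa using hL, ?_, ?_, ?_⟩
      · simp [hy]
        exact hI.skip hu hv
      · simp; omega
      · simp [hy]; omega
    · refine ⟨((hr.setReg (by norm_num) _).setReg (by norm_num) _).setReg (by norm_num) _,
        by simpa using h9, P, O, by simpa using hL, ?_, ?_, ?_⟩
      · simp
        exact hI.issue hx' hu (by simpa using hv)
      · simp; omega
      · simp; omega
  refine Run.of_wp (T := (n + 1) * 60 + 40) ?_ (le_trans (by decide : _ ≤ 40) (by omega))
  rw [issueStep, Prog.wp]
  simp only [Prog.wp.eq_5, Prog.wp.eq_2, Expr.Fits, Expr.val, hr.r0]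
  refine ⟨by omega, fun hv => ⟨by omega, ?_⟩, fun hv => ⟨by omega, ?_⟩⟩
  · rw [if_pos (by omega)] at hu
    rwa [← hu]
  · rw [if_neg (by omega)] at hu
    rwa [← hu]

theorem run_auction (hW : 100 * (n * n) + 100 * n + 1000 ≤ W) (hs : Regs n s) (h9 : s.reg 9 = M)
    (hL : Layout n A H (fun _ => 0) (fun _ => 0) s.mem) (hA : ∀ i j, A i j ≤ 1)
    (hH : ∀ i, H i ≤ 1) :
    Run W auction s ((n + 1) * (n + 1) * (n + 1) * 1000) fun s' => Regs n s' ∧ s'.reg 9 = M ∧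
      ∃ P O, Layout n A H P O s'.mem ∧
        AuctionInv n (fun i j => A i j ≠ 0) (fun i => H i ≠ 0) P O (2 * n) 0 := by
  have h1 : AuctionState n M A H (n * (n + 2) + 4 * n) ((s.setReg 20 0).setReg 21 0) := by
    refine ⟨(hs.setReg (by norm_num) _).setReg (by norm_num) _, by simpa using h9, _, _, hL, ?_, ?_,
      ?_⟩
    · simp only [State.setReg_reg]
      exact AuctionInv.init n _ _ (fun _ _ => rfl) fun _ _ => rfl
    · simp
    · have := auctionSlack_le n fun _ => 0
      simp
      omega
  refine ((Run.of_wp (T := 4) (Q := fun s' => s' = (s.setReg 20 0).setReg 21 0) ?_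
    (by decide)).seq (T' := (n * (n + 2) + 4 * n + 1) * ((2 + ((n + 1) * 60 + 40)) + 7 + 1))
    (R := fun s' => Regs n s' ∧ s'.reg 9 = M ∧
      ∃ P O, Layout n A H P O s'.mem ∧
        AuctionInv n (fun i j => A i j ≠ 0) (fun i => H i ≠ 0) P O (2 * n) 0)
    ?_).mono ?_ fun _ h => h
  · simp [Prog.wp, Expr.Fits, Expr.val]
    omega
  · rintro _ rfl
    refine (Run.loop (I := AuctionState n M A H) (fun k s' hs' => ?_) (fun k s' hs' hv => ?_)
      h1).mono le_rfl ?_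
    · obtain ⟨hr, -, P, O, -, hI, hx, -⟩ := hs'
      have : s'.reg 21 ≤ n := by
        rcases Nat.eq_zero_or_pos (s'.reg 21) with h | h
        · omega
        · have := (hI.active (s'.reg 21 - 1) (by omega)).1
          omega
      simp only [Expr.Fits, Expr.val, hr.r0]
      omega
    · have hk : k ≠ 0 ∧ s'.reg 21 ≤ n ∧ (s'.reg 21 = 0 → s'.reg 20 < 2 * n) := by
        obtain ⟨hr, -, P, O, -, hI, hx, hk⟩ := hs'
        simp only [Expr.val, hr.r0] at hv
        refine ⟨?_, ?_, fun h => by omega⟩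
        · rintro rfl
          split_ifs at hk <;> omega
        · rcases Nat.eq_zero_or_pos (s'.reg 21) with h | h
          · omega
          · have := (hI.active (s'.reg 21 - 1) (by omega)).1
            omega
      obtain ⟨k, rfl⟩ := Nat.exists_eq_succ_of_ne_zero hk.1
      refine ⟨k, rfl, Run.branch ?_ (fun h => run_bidStep hW hA hH hs' h)
        fun h => run_issueStep hW hH hs' h (hk.2.2 h)⟩
      simp only [Expr.Fits]
      omega
    · rintro s' ⟨hv, k, hr, h9, P, O, hL, hI, hx, -⟩
      simp only [Expr.val, hr.r0] at hv
      refine ⟨hr, h9, P, O, hL, ?_⟩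
      have e1 : s'.reg 20 = 2 * n := by omega
      have e2 : s'.reg 21 = 0 := by omega
      rwa [e1, e2] at hI
  · have : n * (n + 2) + 4 * n + 1 ≤ (n + 1) * (n + 1) * 6 := by nlinarith
    have h2 : 2 + ((n + 1) * 60 + 40) + 7 + 1 ≤ (n + 1) * 110 := by omega
    have h3 := Nat.mul_le_mul this h2
    have h4 : 1 ≤ (n + 1) * (n + 1) * (n + 1) := by
      have : 0 < (n + 1) * (n + 1) * (n + 1) := by positivity
      omega
    have h5 : (n + 1) * (n + 1) * 6 * ((n + 1) * 110) = (n + 1) * (n + 1) * (n + 1) * 660 := by ring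
    omega

end RAM

namespace RAM

/-- The memory contains the list `l` of distinct vertices after the first three arrays. -/
structure ListAt (n : ℕ) (l : List ℕ) (m : ℕ → ℕ) : Prop where
  nodup : l.Nodup
  lt : ∀ v ∈ l, v < n
  get : ∀ t, (h : t < l.length) → m (n * n + 3 * n + t) = l[t]

theorem ListAt.length_le {n : ℕ} {l : List ℕ} {m : ℕ → ℕ} (h : ListAt n l m) : l.length ≤ n := by
  rw [← List.toFinset_card_of_nodup h.nodup, ← Finset.card_range n]
  exact Finset.card_le_card fun v hv => Finset.mem_range.2 (h.lt v (List.mem_toFinset.1 hv))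

theorem ListAt.push {n : ℕ} {l : List ℕ} {m : ℕ → ℕ} (h : ListAt n l m) {v : ℕ} (hv : v < n)
    (hvl : v ∉ l) : ListAt n (l ++ [v]) (Function.update m (n * n + 3 * n + l.length) v) := by
  refine ⟨?_, fun w hw => ?_, fun t ht => ?_⟩
  · rw [List.nodup_append_comm]
    simpa using ⟨hvl, h.nodup⟩
  · rcases List.mem_append.1 hw with hw | hw
    · exact h.lt w hw
    · rwa [List.mem_singleton.1 hw]
  · by_cases e : t = l.length
    · subst e
      simp
    · have ht' : t < l.length := by simp at ht; omega
      rw [Function.update_of_ne (by omega), h.get t ht', List.getElem_append_left]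

theorem ListAt.update_of_le {n : ℕ} {l : List ℕ} {m : ℕ → ℕ} (h : ListAt n l m) {a : ℕ}
    (ha : n * n + 4 * n ≤ a) (v : ℕ) : ListAt n l (Function.update m a v) := by
  have := h.length_le
  exact ⟨h.nodup, h.lt, fun t ht => by rw [Function.update_of_ne (by omega)]; exact h.get t ht⟩

/-- Append the content of register `10` to the list. -/
def push : Prog :=
  .seq (.store (.add (.reg 6) (.reg 14)) (.reg 10)) (.assign 14 (.add (.reg 14) (.const 1)))

/-- An expression that is nonzero if the vertex in register `10` has small degree or was bought. -/
def mustKeep : Expr :=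
  .add (.sub (.const 1) (.load (.add (.reg 3) (.reg 10)))) (.load (.add (.reg 4) (.reg 10)))

/-- List the vertices that have to be kept. -/
def collect : Prog :=
  .seq (.assign 14 (.const 0)) (.forLoop 10 0 (.branch mustKeep push .skip))

/-- Append other vertices until the length of the list is given by register `9`. -/
def fill : Prog :=
  .forLoop 10 0
    (.branch (.mul (.sub (.reg 9) (.reg 14)) (.sub (.const 1) mustKeep)) push .skip)

variable {n W M : ℕ} {A : ℕ → ℕ → ℕ} {H P O : ℕ → ℕ} {s : State}

theorem run_collect (hW : 100 * (n * n) + 100 * n + 1000 ≤ W) (hs : Regs n s) (h9 : s.reg 9 = M)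
    (hL : Layout n A H P O s.mem) (hH : ∀ i, H i ≤ 1) (hP : ∀ c < n, P c ≤ n + 2) :
    Run W collect s ((n + 1) * 50) fun s' => Regs n s' ∧ s'.reg 9 = M ∧
      Layout n A H P O s'.mem ∧ ∃ l, ListAt n l s'.mem ∧ s'.reg 14 = l.length ∧
        ∀ v, v ∈ l ↔ v < n ∧ 1 - H v + P v ≠ 0 := by
  refine ((Run.of_wp (T := 2) (Q := fun s' => s' = s.setReg 14 0) ?_ (by decide)).seq
    (T' := (n + 1) * (30 + 10)) (R := fun s' => Regs n s' ∧ s'.reg 9 = M ∧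
      Layout n A H P O s'.mem ∧ ∃ l, ListAt n l s'.mem ∧ s'.reg 14 = l.length ∧
        ∀ v, v ∈ l ↔ v < n ∧ 1 - H v + P v ≠ 0) ?_).mono ?_ fun _ h => h
  · simp [Prog.wp, Expr.Fits, Expr.val]
    omega
  · rintro _ rfl
    refine (Run.forLoop (by omega) (fun i s' => s'.reg 10 = i ∧ Regs n s' ∧ s'.reg 9 = M ∧
      Layout n A H P O s'.mem ∧ ∃ l, ListAt n l s'.mem ∧ s'.reg 14 = l.length ∧
        ∀ v, v ∈ l ↔ v < i ∧ 1 - H v + P v ≠ 0) ?_ ?_ ?_).mono le_rfl fun _ h => h.2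
    · rintro i s' ⟨h1, h2, -⟩
      exact ⟨h1, h2.r0⟩
    · exact ⟨by simp, (hs.setReg (by norm_num) _).setReg (by norm_num) _, by simpa using h9, hL, [],
        ⟨by simp, by simp, by simp⟩, by simp, by simp⟩
    · rintro i s' hi ⟨h1, h2, h3, h4, l, h5, h6, h7⟩
      refine Run.of_wp ?_ (by decide)
      have hHi := hH i
      have hPi := hP i hi
      have hlen := h5.length_le
      have hil : i ∉ l := fun h => by have := ((h7 i).1 h).1; omega
      simp only [push, mustKeep, Prog.wp, Expr.Fits, Expr.val, h1, h2.r3, h2.r4, h2.r6, h6,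
        h4.hi i hi, h4.price i hi, State.setMem_reg]
      refine ⟨by omega, fun hv => ⟨by omega, by omega, by omega, ?_⟩, fun hv => ?_⟩
      · refine ⟨by simp [h1], by simp, ((h2.setMem _ _).setReg (by norm_num) _).setReg
          (by norm_num) _, by simpa using h3, h4.update_of_le (by omega) _, l ++ [i],
          h5.push hi hil, by simp, fun v => ?_⟩
        rw [List.mem_append, List.mem_singleton, h7]
        constructor
        · rintro (h | rfl)
          · exact ⟨by omega, h.2⟩
          · exact ⟨by omega, hv⟩
        · rintro ⟨h, h'⟩
          by_cases e : v = i
          · exact Or.inr e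
          · exact Or.inl ⟨by omega, h'⟩
      · refine ⟨trivial, by simp, h2.setReg (by norm_num) _, by simpa using h3, h4, l, h5,
          by simpa using h6, fun v => ?_⟩
        rw [h7]
        constructor
        · rintro ⟨h, h'⟩
          exact ⟨by omega, h'⟩
        · rintro ⟨h, h'⟩
          refine ⟨?_, h'⟩
          have : v ≠ i := fun e => h' (e ▸ hv)
          omega
  · omega

theorem run_fill (hW : 100 * (n * n) + 100 * n + 1000 ≤ W) (hs : Regs n s) (h9 : s.reg 9 = M)
    (hL : Layout n A H P O s.mem) (hH : ∀ i, H i ≤ 1) (hP : ∀ c < n, P c ≤ n + 2)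
    (hM : M < n) {l : List ℕ} (hl : ListAt n l s.mem) (h14 : s.reg 14 = l.length)
    (hlM : l.length ≤ M) (hmem : ∀ v, v ∈ l ↔ v < n ∧ 1 - H v + P v ≠ 0) :
    Run W fill s ((n + 1) * 50) fun s' => Regs n s' ∧ s'.reg 9 = M ∧
      Layout n A H P O s'.mem ∧ ∃ l, ListAt n l s'.mem ∧ l.length = M ∧
        ∀ v < n, 1 - H v + P v ≠ 0 → v ∈ l := by
  refine (Run.forLoop (W := W) (T := 40) (N := n) (by omega) (fun i s' => s'.reg 10 = i ∧ Regs n s' ∧ s'.reg 9 = M ∧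
    Layout n A H P O s'.mem ∧ ∃ l, ListAt n l s'.mem ∧ s'.reg 14 = l.length ∧ l.length ≤ M ∧
      (∀ v < n, 1 - H v + P v ≠ 0 → v ∈ l) ∧ (∀ v ∈ l, 1 - H v + P v = 0 → v < i) ∧
      (l.length < M → ∀ v < i, v ∈ l)) ?_ ?_ ?_).mono (by omega) ?_
  · rintro i s' ⟨h1, h2, -⟩
    exact ⟨h1, h2.r0⟩
  · exact ⟨by simp, hs.setReg (by norm_num) _, by simpa using h9, hL, l, hl, by simpa using h14, hlM,
      fun v hv hv' => (hmem v).2 ⟨hv, hv'⟩, fun v hv hv' => absurd hv' ((hmem v).1 hv).2, by simp⟩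
  · rintro i s' hi ⟨h1, h2, h3, h4, l, h5, h6, h7, h8, h10, h11⟩
    refine Run.of_wp ?_ (by decide)
    have hHi := hH i
    have hPi := hP i hi
    have hlen := h5.length_le
    have b1 : (M - l.length) * (1 - (1 - H i + P i)) ≤ n := by
      have := Nat.mul_le_mul (Nat.sub_le M l.length) (Nat.sub_le 1 (1 - H i + P i))
      omega
    simp only [push, mustKeep, Prog.wp, Expr.Fits, Expr.val, h1, h2.r3, h2.r4, h2.r6, h6, h3,
      h4.hi i hi, h4.price i hi, State.setMem_reg]
    refine ⟨by omega, fun hv => ⟨by omega, by omega, by omega, ?_⟩, fun hz => ?_⟩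
    · have hv' : M - l.length ≠ 0 ∧ 1 - (1 - H i + P i) ≠ 0 := by
        simpa only [ne_eq, Nat.mul_eq_zero, not_or] using hv
      have hil : i ∉ l := fun h => by have := h10 i h (by omega); omega
      refine ⟨by simp [h1], by simp, ((h2.setMem _ _).setReg (by norm_num) _).setReg
        (by norm_num) _, by simpa using h3, h4.update_of_le (by omega) _, l ++ [i],
        h5.push hi hil, by simp, ?_, fun v hv h => ?_, fun v hv h => ?_, fun h v hv => ?_⟩
      · simp
        omega
      · exact List.mem_append_left _ (h8 v hv h)
      · rcases List.mem_append.1 hv with hv | hv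
        · have := h10 v hv h
          omega
        · have := List.mem_singleton.1 hv
          omega
      · by_cases e : v = i
        · simp [e]
        · exact List.mem_append_left _ (h11 (by omega) v (by omega))
    · refine ⟨trivial, by simp, h2.setReg (by norm_num) _, by simpa using h3, h4, l, h5,
        by simpa using h6, h7, h8, fun v hv h => ?_, fun h v hv => ?_⟩
      · have := h10 v hv h
        omega
      · by_cases e : v = i
        · rw [e]
          refine h8 i hi ?_
          rcases Nat.mul_eq_zero.1 hz with h' | h' <;> omega
        · exact h11 h v (by omega)
  · rintro s' ⟨-, h2, h3, h4, l, h5, -, h7, h8, -, h11⟩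
    refine ⟨h2, h3, h4, l, h5, ?_, h8⟩
    by_contra hne
    have h12 := h11 (by omega)
    have : (Finset.range n).card ≤ l.toFinset.card :=
      Finset.card_le_card fun v hv => List.mem_toFinset.2 (h12 v (Finset.mem_range.1 hv))
    rw [Finset.card_range, List.toFinset_card_of_nodup h5.nodup] at this
    omega

/-- Write row number `i` of the new adjacency matrix, where `i` is in register `10`. -/
def writeRow : Prog :=
  .seq (.assign 15 (.load (.add (.reg 6) (.reg 10)))) <|
  .forLoop 11 9 <|
    .seq (.assign 16 (.load (.add (.reg 6) (.reg 11)))) <|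
    .seq (.assign 17 (.add (.load (.add (.mul (.reg 15) (.reg 0)) (.reg 16)))
      (.mul (.load (.add (.reg 3) (.reg 15))) (.mul (.load (.add (.reg 3) (.reg 16)))
        (.add (.sub (.reg 10) (.reg 11)) (.sub (.reg 11) (.reg 10))))))) <|
    .store (.add (.add (.reg 7) (.mul (.reg 10) (.reg 9))) (.reg 11))
      (.sub (.const 1) (.sub (.const 1) (.reg 17)))

/-- Write the adjacency matrix of the graph that is induced on the listed vertices when the
vertices of large degree are made pairwise adjacent. -/
def output : Prog :=
  .seq (.forLoop 10 9 writeRow) (.seq (.assign 1 (.reg 7)) (.assign 0 (.reg 9)))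

/-- The new adjacency matrix. -/
def newAdj (A : ℕ → ℕ → ℕ) (H : ℕ → ℕ) (l : List ℕ) (i j : ℕ) : ℕ :=
  1 - (1 - (A (l.getD i 0) (l.getD j 0)
    + H (l.getD i 0) * (H (l.getD j 0) * ((i - j) + (j - i)))))

/-- The states during the output, when the rows before `i` and the first `j` entries of row `i`
have been written. -/
def OutputState (n M : ℕ) (A : ℕ → ℕ → ℕ) (H P O : ℕ → ℕ) (l : List ℕ) (i j : ℕ) (s : State) :
    Prop :=
  s.reg 10 = i ∧ Regs n s ∧ s.reg 9 = M ∧ Layout n A H P O s.mem ∧ ListAt n l s.mem ∧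
    (∀ a < i, ∀ b < M, s.mem (n * n + 4 * n + a * M + b) = newAdj A H l a b) ∧
    ∀ b < j, s.mem (n * n + 4 * n + i * M + b) = newAdj A H l i b

theorem run_writeRow (hW : 100 * (n * n) + 100 * n + 1000 ≤ W) (hA : ∀ i j, A i j ≤ 1)
    (hH : ∀ i, H i ≤ 1) (hM : M < n) {l : List ℕ} (hlM : l.length = M) {i : ℕ} (hi : i < M)
    (hs : OutputState n M A H P O l i 0 s) :
    Run W writeRow s ((n + 1) * 100) (OutputState n M A H P O l i M) := by
  obtain ⟨h1, h2, h3, h4, h5, h6, -⟩ := hs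
  have hg : ∀ j < M, s.mem (n * n + 3 * n + j) = l.getD j 0 ∧ l.getD j 0 < n := by
    intro j hj
    have hj' : j < l.length := by omega
    rw [List.getD_eq_getElem _ _ hj']
    exact ⟨h5.get j hj', h5.lt _ (List.getElem_mem hj')⟩
  obtain ⟨g1, g2⟩ := hg i hi
  refine ((Run.of_wp (T := 10) (Q := fun s' => s' = s.setReg 15 (l.getD i 0)) ?_ (by decide)).seq
    (T' := (M + 1) * (60 + 10)) (R := OutputState n M A H P O l i M) ?_).mono ?_ fun _ h => h
  · simp only [Prog.wp, Expr.Fits, Expr.val, h2.r6, h1, g1]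
    exact ⟨by omega, trivial⟩
  · rintro _ rfl
    refine (Run.forLoop (by omega) (fun j s' => s'.reg 11 = j ∧ s'.reg 15 = l.getD i 0 ∧
      OutputState n M A H P O l i j s') ?_ ?_ ?_).mono le_rfl fun _ h => h.2.2
    · rintro j s' ⟨h1, -, -, -, h3, -⟩
      exact ⟨h1, h3⟩
    · exact ⟨by simp, by simp, by simpa using h1, (h2.setReg (by norm_num) _).setReg
        (by norm_num) _, by simpa using h3, h4, h5, h6, by simp⟩
    · rintro j s' hj ⟨e11, e15, h1, h2, h3, h4, h5, h6, h7⟩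
      refine Run.of_wp ?_ (by decide)
      have hj' : j < l.length := by omega
      have m1 : s'.mem (n * n + 3 * n + j) = l.getD j 0 := by
        rw [List.getD_eq_getElem _ _ hj']
        exact h5.get j hj'
      have g3 := (hg j hj).2
      set u := l.getD i 0 with hu
      set v := l.getD j 0 with hv
      have m2 := h4.adj u g2 v g3
      have m3 := h4.hi u g2
      have m4 := h4.hi v g3
      have hAuv := hA u v
      have hHu := hH u
      have hHv := hH v
      have b0 := mul_add_le_mul (n := n) g2
      have b1 : H v * ((i - j) + (j - i)) ≤ n :=
        (Nat.mul_le_mul_right _ hHv).trans (by omega)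
      have b2 : H u * (H v * ((i - j) + (j - i))) ≤ n :=
        (Nat.mul_le_mul hHu b1).trans (by omega)
      have b3 : i * M + M ≤ n * n :=
        (mul_add_le_mul (n := M) hi).trans (Nat.mul_le_mul hM.le hM.le)
      have hn : newAdj A H l i j = 1 - (1 - (A u v + H u * (H v * ((i - j) + (j - i))))) := rfl
      have r0 := h2.r0
      have r3 := h2.r3
      have r6 := h2.r6
      have r7 := h2.r7
      simp only [Prog.wp, Expr.Fits, Expr.val, State.setReg_reg, State.setReg_mem,
        Nat.reduceEqDiff, if_false, if_true, OfNat.zero_ne_ofNat, r0, r3, r6, r7, e11, e15, h1, h3,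
        m1, m2, m3, m4]
      refine ⟨by omega, by omega, by omega, by omega, by simp [e11], by simp, by simp [e15],
        by simpa using h1, (((h2.setReg (by norm_num) _).setReg (by norm_num) _).setMem _ _).setReg
        (by norm_num) _, by simpa using h3, h4.update_of_le (by omega) _,
        h5.update_of_le (by omega) _, fun a ha b hb => ?_, fun b hb => ?_⟩
      · have b4 : a * M + M ≤ i * M := mul_add_le_mul ha
        simp only [State.setReg_mem, State.setMem_mem]
        rw [Function.update_of_ne (by omega)]
        exact h6 a ha b hb
      · simp only [State.setReg_mem, State.setMem_mem]
        by_cases e : b = j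
        · rw [e, Function.update_self, hn]
        · rw [Function.update_of_ne (by omega)]
          exact h7 b (by omega)
  · omega

theorem run_output (hW : 100 * (n * n) + 100 * n + 1000 ≤ W) (hs : Regs n s) (h9 : s.reg 9 = M)
    (hL : Layout n A H P O s.mem) (hA : ∀ i j, A i j ≤ 1) (hH : ∀ i, H i ≤ 1) (hM : M < n)
    {l : List ℕ} (hl : ListAt n l s.mem) (hlM : l.length = M) :
    Run W output s ((n + 1) * (n + 1) * 200) fun s' => s'.reg 0 = M ∧
      ∀ i < M, ∀ j < M, s'.mem (s'.reg 1 + i * M + j) = newAdj A H l i j := by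
  refine (Run.seq (T := (M + 1) * ((n + 1) * 100 + 10)) (T' := 4)
    (Q := OutputState n M A H P O l M 0) ?_ fun s' ⟨_, h2, h3, _, _, h6, _⟩ =>
      Run.of_wp ?_ (by decide)).mono ?_ fun _ h => h
  · refine Run.forLoop (by omega) (fun i => OutputState n M A H P O l i 0) ?_ ?_ ?_
    · rintro i s' ⟨h1, -, h3, -⟩
      exact ⟨h1, h3⟩
    · exact ⟨by simp, hs.setReg (by norm_num) _, by simpa using h9, hL, hl, by simp, by simp⟩
    · intro i s' hi hs'
      refine (run_writeRow hW hA hH hM hlM hi hs').mono le_rfl ?_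
      rintro s'' ⟨h1, h2, h3, h4, h5, h6, h7⟩
      refine ⟨h1, by simp, h2.setReg (by norm_num) _, by simpa using h3, h4, h5, fun a ha => ?_,
        by simp⟩
      by_cases e : a = i
      · subst e
        exact h7
      · exact h6 a (by omega)
  · have r7 := h2.r7
    simp [Prog.wp, Expr.Fits, Expr.val, r7, h3]
    exact ⟨by omega, by omega, fun i hi j hj => h6 i hi j hj⟩
  · have h1 : (M + 1) * ((n + 1) * 100 + 10) ≤ (n + 1) * ((n + 1) * 110) :=
      Nat.mul_le_mul (by omega) (by omega)
    have h2 : (n + 1) * ((n + 1) * 110) = (n + 1) * (n + 1) * 110 := by ring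
    have h3 : 1 ≤ (n + 1) * (n + 1) := Nat.one_le_iff_ne_zero.2 (by positivity)
    omega

end RAM

namespace RAM

/-- The reduction: if there are few vertices of small degree, hold the auction and keep the vertices
of small degree, the bought ones, and some others. -/
def reduce : Prog :=
  .seq setup <| .seq classify <|
  .seq (.assign 9 (.mul (.const 3) (.add (.reg 8) (.sub (.const 1) (.reg 8))))) <|
  .branch (.sub (.reg 0) (.reg 9)) (.seq auction <| .seq collect <| .seq fill output) .skip

variable {n W : ℕ} {A : ℕ → ℕ → ℕ} {H P O : ℕ → ℕ} {s : State}

theorem sum_one_sub_eq_card (hH : ∀ i, H i ≤ 1) :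
    ∑ i ∈ Finset.range n, (1 - H i) = ((Finset.range n).filter fun v => H v = 0).card := by
  rw [Finset.card_filter]
  refine Finset.sum_congr rfl fun i _ => ?_
  have := hH i
  split_ifs <;> omega

theorem length_collected_le (hH : ∀ i, H i ≤ 1) {adj : ℕ → ℕ → Prop}
    (hI : AuctionInv n adj (fun i => H i ≠ 0) P O (2 * n) 0) {l : List ℕ} (hl : l.Nodup)
    (hmem : ∀ v, v ∈ l ↔ v < n ∧ 1 - H v + P v ≠ 0) :
    l.length ≤ 3 * ∑ i ∈ Finset.range n, (1 - H i) := by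
  have h1 := hI.card_le
  simp only [ne_eq, not_not] at h1
  have h2 : l.toFinset ⊆ ((Finset.range n).filter fun v => H v = 0) ∪
      (Finset.range n).filter fun v => 0 < P v := by
    intro v hv
    obtain ⟨hv1, hv2⟩ := (hmem v).1 (List.mem_toFinset.1 hv)
    rw [Finset.mem_union, Finset.mem_filter, Finset.mem_filter, Finset.mem_range]
    have := hH v
    by_cases h0 : H v = 0
    · exact Or.inl ⟨hv1, h0⟩
    · exact Or.inr ⟨hv1, by omega⟩
  have h3 := (Finset.card_le_card h2).trans (Finset.card_union_le _ _)
  rw [List.toFinset_card_of_nodup hl] at h3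
  rw [sum_one_sub_eq_card hH]
  omega

theorem run_reduce (hW : 100 * (n * n) + 100 * n + 1000 ≤ W) (h0 : s.reg 0 = n) (h1 : s.reg 1 = 0)
    (hL : Layout n A (fun _ => 0) (fun _ => 0) (fun _ => 0) s.mem) (hA : ∀ i j, A i j ≤ 1) :
    Run W reduce s ((n + 1) * (n + 1) * (n + 1) * 1500) fun s' => ∃ H : ℕ → ℕ, ∃ M,
      (∀ i, H i ≤ 1) ∧ (∀ i < n, H i = hiFlag n (∑ j ∈ Finset.range n, A i j)) ∧
      M = 3 * (∑ i ∈ Finset.range n, (1 - H i) + (1 - ∑ i ∈ Finset.range n, (1 - H i))) ∧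
      ((n ≤ M ∧ s'.reg 0 = n ∧ s'.reg 1 = 0 ∧ ∀ i < n, ∀ j < n, s'.mem (i * n + j) = A i j) ∨
        ∃ P O l, l.length = M ∧ M < n ∧ l.Nodup ∧ (∀ v ∈ l, v < n) ∧
          (∀ v < n, 1 - H v + P v ≠ 0 → v ∈ l) ∧
          AuctionInv n (fun i j => A i j ≠ 0) (fun i => H i ≠ 0) P O (2 * n) 0 ∧
          s'.reg 0 = M ∧
          ∀ i < M, ∀ j < M, s'.mem (s'.reg 1 + i * M + j) = newAdj A H l i j) := by
  refine Run.mono (T := 20 + ((n + 1) * (n + 1) * 70 + (10 + (3 + 1 +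
    ((n + 1) * (n + 1) * (n + 1) * 1000 + ((n + 1) * 50 + ((n + 1) * 50 +
      (n + 1) * (n + 1) * 200))))))) ?_ ?_ fun _ h => h
  · refine (run_setup hW h0 h1).seq fun s₁ ⟨a1, a2⟩ => ?_
    refine (run_classify (P := fun _ => 0) (O := fun _ => 0) hW a2 (by rwa [a1]) hA).seq fun s₂ ⟨b1, H, b2, b3, b4, b5⟩ => ?_
    set S := ∑ i ∈ Finset.range n, (1 - H i) with hS
    have hSn : S ≤ n := by
      refine (Finset.sum_le_card_nsmul _ _ 1 fun k _ => Nat.sub_le _ _).trans (by simp)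
    refine (Run.of_wp (T := 10) (Q := fun s' => s' = s₂.setReg 9 (3 * (S + (1 - S)))) ?_
      (by decide)).seq ?_
    · simp only [Prog.wp, Expr.Fits, Expr.val, b5]
      exact ⟨by omega, trivial⟩
    rintro _ rfl
    have c1 := b1.setReg (r := 9) (by norm_num) (3 * (S + (1 - S)))
    have hr0 := c1.r0
    refine Run.branch ?_ (fun hv => ?_) fun hv => Run.of_wp ?_ ?_
    · simp only [Expr.Fits, hr0, State.setReg_reg, if_true]
      omega
    · simp only [Expr.val, hr0, State.setReg_reg, if_true] at hv
      refine (run_auction (A := A) (M := 3 * (S + (1 - S))) hW c1 (by simp) b2 hA b3).seq fun s₃ ⟨d1, d2, P, O, d3, d4⟩ => ?_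
      refine (run_collect hW d1 d2 d3 b3 d4.price_le).seq fun s₄ ⟨e1, e2, e3, l, e4, e5, e6⟩ => ?_
      have hlen := length_collected_le b3 d4 e4.nodup e6
      refine (run_fill hW e1 e2 e3 b3 d4.price_le (by omega) e4 e5 (by omega) e6).seq
        fun s₅ ⟨f1, f2, f3, l', f4, f5, f6⟩ => ?_
      refine (run_output hW f1 f2 f3 hA b3 (by omega) f4 f5).mono le_rfl fun s₆ ⟨g1, g2⟩ => ?_
      exact ⟨H, _, b3, b4, rfl, Or.inr ⟨P, O, l', f5, by omega, f4.nodup, f4.lt, f6, d4, g1, g2⟩⟩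
    · simp only [Expr.val, hr0, State.setReg_reg, if_true] at hv
      exact ⟨H, _, b3, b4, rfl, Or.inl ⟨by omega, hr0, c1.r1, b2.adj⟩⟩
    · simp only [Prog.size]
      have : 1 ≤ (n + 1) * (n + 1) * (n + 1) := Nat.one_le_iff_ne_zero.2 (by positivity)
      omega
  · have h1 : 1 ≤ n + 1 := by omega
    have h2 : n + 1 ≤ (n + 1) * (n + 1) := Nat.le_mul_of_pos_left _ h1
    have h3 : (n + 1) * (n + 1) ≤ (n + 1) * (n + 1) * (n + 1) := Nat.le_mul_of_pos_right _ h1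
    omega

end RAM

namespace SimpleGraph

open Classical in
/-- The outcome of the auction determines an induced subgraph that is equivalent with respect to
Hamiltonicity. -/
theorem isHamiltonian_iff_of_auction {n : ℕ} (G : SimpleGraph (Fin n)) [DecidableRel G.Adj]
    {C : Finset (Fin n)} (hC : ∀ v ∈ C, n ≤ 2 * G.degree v) {adj : ℕ → ℕ → Prop} {hi : ℕ → Prop}
    {P O : ℕ → ℕ} (hadj : ∀ i j : Fin n, adj i j ↔ G.Adj i j) (hhi : ∀ i : Fin n, hi i ↔ i ∈ C)
    (hI : AuctionInv n adj hi P O (2 * n) 0) {m : ℕ} (e : Fin m ↪ Fin n)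
    (he : ∀ v : Fin n, v ∉ C ∨ 0 < P v → ∃ i, e i = v) (hm : 3 ≤ m)
    (hmC : 2 * (Cᶜ).card < m) :
    G.IsHamiltonian ↔ ((G.addClique C).comap e).IsHamiltonian := by
  have hmn : m ≤ n := by simpa using Fintype.card_le_of_embedding e
  obtain ⟨Z, hZ, hgap⟩ := hI.exists_gap
  have hown : ∀ v p : Fin n, O p = v + 1 → p ∈ C ∧ (∃ i, e i = p) ∧ (G.addClique C).Adj v p := by
    intro v p h
    obtain ⟨-, -, h1, h2⟩ := hI.adj_of_owner p p.2 v h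
    have h3 : P p ≠ 0 := fun h0 => by
      have := (hI.owner_eq_zero p p.2).2 h0
      omega
    exact ⟨(hhi p).1 h1, he p (Or.inr (Nat.pos_of_ne_zero h3)),
      G.le_addClique C ((hadj v p).1 h2)⟩
  let C' : Finset (Fin n) := C.filter fun v => ∃ i, e i = v
  let Z' : Finset (Fin n) := Finset.univ.filter fun v => (v : ℕ) ∈ Z
  let Q : Fin n → Fin n → Prop := fun v p => (p : ℕ) ∉ Z ∧ O p = v + 1
  let R : Finset (Fin n) := Cᶜ.filter fun v => ∃ p q, p ≠ q ∧ Q v p ∧ Q v q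
  have hU : Cᶜ ∪ C' = Finset.univ.map e := by
    ext v
    simp only [C', Finset.mem_union, Finset.mem_compl, Finset.mem_filter, Finset.mem_map,
      Finset.mem_univ, true_and]
    have := he v
    tauto
  have hUcard : (Cᶜ ∪ C').card = m := by rw [hU]; simp
  have hdisj : Disjoint Cᶜ C' :=
    disjoint_compl_left.mono_right (Finset.filter_subset _ _)
  rw [isHamiltonian_iff_exists_hamCycleOn (by simp; omega),
    isHamiltonian_iff_exists_hamCycleOn (by simpa), ← G.exists_hamCycleOn_addClique_iff (C := C)
      (by simpa using hC) (by simp; omega), exists_hamCycleOn_univ_comap_iff (U := Cᶜ ∪ C') e]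
  · refine exists_hamCycleOn_univ_iff (C := C) (Z := Z') (R := R) (P := Q)
      (fun x hx y hy hxy => ⟨hxy, Or.inr ⟨hx, hy⟩⟩) (Finset.filter_subset _ _) (fun v hv => ?_)
      (disjoint_compl_left.mono_left (Finset.filter_subset _ _)) (fun v hv hvR c hc hvc => ?_)
      (fun v p hp => ?_) (fun v v' p hp hp' => ?_) (fun v hv => (Finset.mem_filter.1 hv).2) ?_
      (by omega)
    · obtain ⟨-, h1⟩ := hZ v (Finset.mem_filter.1 hv).2
      have h2 : O v ≠ 0 := fun h0 => by
        have := (hI.owner_eq_zero v v.2).1 h0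
        omega
      have h3 := (hI.adj_of_owner v v.2 (O v - 1) (by omega)).2.2.1
      exact Finset.mem_filter.2 ⟨(hhi v).1 h3, he v (Or.inr h1)⟩
    · refine Finset.mem_filter.2 ⟨Finset.mem_univ _, ?_⟩
      rcases hgap v v.2 (fun h => hv ((hhi v).1 h)) with h | ⟨p, hp, q, hq, hpq, h1, h2, h3, h4⟩
      · refine h c c.2 ((hhi c).2 hc) ((hadj v c).2 ?_)
        rcases hvc.2 with h | h
        · exact h
        · exact absurd h.1 hv
      · exact absurd (Finset.mem_filter.2 ⟨Finset.mem_compl.2 hv, ⟨p, hp⟩, ⟨q, hq⟩,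
          fun h => hpq (Fin.mk.inj_iff.1 h), ⟨h1, h3⟩, h2, h4⟩) hvR
    · obtain ⟨h1, h2, h3⟩ := hown v p hp.2
      exact ⟨Finset.mem_filter.2 ⟨h1, h2⟩, fun h => hp.1 (Finset.mem_filter.1 h).2, h3⟩
    · have h1 := hp.2
      have h2 := hp'.2
      exact Fin.ext (by omega)
    · rw [Finset.card_union_of_disjoint hdisj] at hUcard
      omega
  · intro x
    rw [hU]
    simp

end SimpleGraph

namespace RAM

open Classical in
/-- The adjacency matrix, extended by zeros. -/
noncomputable def adjMat {n : ℕ} (G : SimpleGraph (Fin n)) (i j : ℕ) : ℕ :=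
  if ∃ (hi : i < n) (hj : j < n), G.Adj ⟨i, hi⟩ ⟨j, hj⟩ then 1 else 0

theorem adjMat_le {n : ℕ} (G : SimpleGraph (Fin n)) (i j : ℕ) : adjMat G i j ≤ 1 := by
  unfold adjMat
  split_ifs <;> omega

open Classical in
theorem adjMat_fin {n : ℕ} (G : SimpleGraph (Fin n)) (i j : Fin n) :
    adjMat G i j = if G.Adj i j then 1 else 0 := by
  simp [adjMat]

theorem layout_input {n : ℕ} (G : SimpleGraph (Fin n)) :
    Layout n (adjMat G) (fun _ => 0) (fun _ => 0) (fun _ => 0) (input G).mem := by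
  have hz : ∀ a, n * n ≤ a → (input G).mem a = 0 := by
    intro a ha
    refine if_neg ?_
    rintro ⟨i, j, h, -⟩
    have := mul_add_le_mul (n := n) i.2
    have := j.2
    omega
  refine ⟨fun i hi j hj => ?_, fun i _ => hz _ (by omega), fun i _ => hz _ (by omega),
    fun i _ => hz _ (by omega)⟩
  suffices key : (∃ i' j' : Fin n, i * n + j = i' * n + j' ∧ G.Adj i' j') ↔
      ∃ (hi : i < n) (hj : j < n), G.Adj ⟨i, hi⟩ ⟨j, hj⟩ by
    simp only [input, adjMat]
    by_cases h : ∃ (hi : i < n) (hj : j < n), G.Adj ⟨i, hi⟩ ⟨j, hj⟩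
    · rw [if_pos h, if_pos (key.2 h)]
    · rw [if_neg h, if_neg (mt key.1 h)]
  constructor
  · rintro ⟨i', j', h, hG⟩
    have h1 : (i : ℕ) = i' := by
      rcases lt_trichotomy i i' with h' | h' | h'
      · have := mul_add_le_mul (n := n) h'
        omega
      · exact h'
      · have := mul_add_le_mul (n := n) h'
        omega
    subst h1
    have h2 : (j : ℕ) = j' := by omega
    subst h2
    exact ⟨i'.2, j'.2, hG⟩
  · rintro ⟨h1, h2, hG⟩
    exact ⟨_, _, rfl, hG⟩

theorem sum_adjMat {n : ℕ} (G : SimpleGraph (Fin n)) [DecidableRel G.Adj] (i : Fin n) :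
    ∑ j ∈ Finset.range n, adjMat G i j = G.degree i := by
  classical
  rw [Finset.sum_range, ← G.card_neighborFinset_eq_degree, G.neighborFinset_eq_filter,
    Finset.card_filter]
  exact Finset.sum_congr rfl fun j _ => by rw [adjMat_fin]; congr

open Classical in
theorem newAdj_eq {n : ℕ} (G : SimpleGraph (Fin n)) {C : Finset (Fin n)} {H : ℕ → ℕ} (hC : ∀ v : Fin n, H v ≠ 0 ↔ v ∈ C) {l : List ℕ}
    (e : Fin l.length ↪ Fin n) (he : ∀ i, (e i : ℕ) = l[i]) (i j : Fin l.length) :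
    newAdj (adjMat G) H l i j = if ((G.addClique C).comap e).Adj i j then 1 else 0 := by
  have h1 : ∀ i : Fin l.length, l.getD i 0 = e i := fun i => by
    rw [List.getD_eq_getElem _ _ i.2, he]
    rfl
  have hadj : ((G.addClique C).comap e).Adj i j ↔
      e i ≠ e j ∧ (G.Adj (e i) (e j) ∨ e i ∈ C ∧ e j ∈ C) := Iff.rfl
  rw [newAdj, h1, h1, adjMat_fin, if_congr hadj rfl rfl]
  by_cases hij : i = j
  · subst hij
    simp
  have hij' : (i : ℕ) - j + (j - i) ≠ 0 := by
    have : (i : ℕ) ≠ j := fun h => hij (Fin.ext h)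
    omega
  have hCi := hC (e i)
  have hCj := hC (e j)
  have hne : e i ≠ e j := fun h => hij (e.injective h)
  by_cases hG : G.Adj (e i) (e j)
  · simp [hG, hne]
  · simp only [hG, hne, if_false, zero_add, ne_eq, not_false_eq_true, true_and, false_or]
    by_cases hmem : e i ∈ C ∧ e j ∈ C
    · rw [if_pos hmem]
      have : H (e i) * (H (e j) * ((i : ℕ) - j + (j - i))) ≠ 0 :=
        Nat.mul_ne_zero (hCi.2 hmem.1) (Nat.mul_ne_zero (hCj.2 hmem.2) hij')
      omega
    · rw [if_neg hmem]
      have : H (e i) * (H (e j) * ((i : ℕ) - j + (j - i))) = 0 := by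
        by_contra h
        simp only [Nat.mul_eq_zero, not_or] at h
        exact hmem ⟨hCi.1 h.1, hCj.1 h.2.1⟩
      rw [this]

theorem le_word_size (n : ℕ) {c : ℕ} (hc : 10 ≤ c) :
    100 * (n * n) + 100 * n + 1000 ≤ (n + 2) ^ c := by
  have h1 : (n + 2) ^ 10 ≤ (n + 2) ^ c := Nat.pow_le_pow_right (by omega) hc
  have h2 : 2 ^ 8 ≤ (n + 2) ^ 8 := Nat.pow_le_pow_left (by omega) 8
  have h3 : (n + 2) ^ 10 = (n + 2) ^ 8 * ((n + 2) * (n + 2)) := by ring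
  have h4 := Nat.mul_le_mul_right ((n + 2) * (n + 2)) h2
  have h5 : (n + 2) * (n + 2) = n * n + 4 * n + 4 := by ring
  rw [← h3, h5] at h4
  omega

end RAM

theorem theorem1 :
    ∃ (P : RAM.Prog) (c : ℕ),
      ∀ (n : ℕ) (G : SimpleGraph (Fin n)) [DecidableRel G.Adj] (k : ℕ), 1 ≤ k →
        (n : ℤ) - (k : ℤ) ≤
          ((Finset.univ.filter fun v : Fin n => (n : ℚ) / 2 ≤ (G.degree v : ℚ)).card : ℤ) →
        ∃ (t : ℕ) (s : RAM.State) (m : ℕ) (G' : SimpleGraph (Fin m)),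
          RAM.Exec ((n + 2) ^ c) P (RAM.input G) t s ∧
          t ≤ c * (n ^ 3 + 1) ∧
          s.Contains G' ∧
          m ≤ 3 * k ∧
          (G.IsHamiltonian ↔ G'.IsHamiltonian) := by
  obtain ⟨c, hc⟩ : ∃ c, c = 12000 := ⟨_, rfl⟩
  refine ⟨RAM.reduce, c, fun n G _ k hk hdeg => ?_⟩
  obtain ⟨t, s, hexec, ht, H, M, hH, hHd, hM, hout⟩ := RAM.run_reduce
    (RAM.le_word_size n (c := c) (by omega))
    (s := RAM.input G) rfl rfl (RAM.layout_input G) (RAM.adjMat_le G)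
  have ht' : t ≤ c * (n ^ 3 + 1) := by
    rw [hc]
    refine ht.trans ?_
    have : (n + 1) * (n + 1) * (n + 1) ≤ 8 * (n ^ 3 + 1) := by nlinarith [sq_nonneg ((n : ℤ) - 1)]
    omega
  set C : Finset (Fin n) := Finset.univ.filter fun v : Fin n => n ≤ 2 * G.degree v with hC
  have hHC : ∀ v : Fin n, H v ≠ 0 ↔ v ∈ C := fun v => by
    rw [hHd v v.2, RAM.sum_adjMat, hC, Finset.mem_filter, RAM.hiFlag]
    simp only [Finset.mem_univ, true_and]
    omega
  have hCeq : (Finset.univ.filter fun v : Fin n => (n : ℚ) / 2 ≤ (G.degree v : ℚ)) = C := by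
    refine Finset.filter_congr fun v _ => ?_
    rw [div_le_iff₀ (by norm_num : (0 : ℚ) < 2)]
    norm_cast
    rw [mul_comm]
  have hS : ∑ i ∈ Finset.range n, (1 - H i) = (Cᶜ).card := by
    rw [Finset.sum_range, Finset.card_eq_sum_ones, ← Finset.sum_filter_add_sum_filter_not
      (Finset.univ : Finset (Fin n)) (· ∈ C)]
    have h1 : ∑ i ∈ Finset.univ.filter (· ∈ C), (1 - H (i : Fin n)) = 0 :=
      Finset.sum_eq_zero fun i hi => by
        have := (hHC i).2 (Finset.mem_filter.1 hi).2
        omega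
    rw [h1, zero_add]
    refine Finset.sum_congr (by ext; simp) fun i hi => ?_
    have := (hHC i).not.2 (Finset.mem_compl.1 hi)
    omega
  have hSk : (Cᶜ).card ≤ k := by
    rw [hCeq] at hdeg
    have := C.card_add_card_compl
    rw [Fintype.card_fin] at this
    omega
  rw [hS] at hM
  have hMk : M ≤ 3 * k := by omega
  rcases hout with ⟨hnM, h0, h1, hmem⟩ | ⟨P, O, l, hl, hMn, hnd, hlt, hkeep, hI, h0, hmem⟩
  · refine ⟨t, s, n, G, hexec, ht', ⟨h0, fun i j => ?_⟩, by omega, Iff.rfl⟩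
    rw [h1, zero_add, hmem i i.2 j j.2, RAM.adjMat_fin]
  · subst hl
    let e : Fin l.length ↪ Fin n := ⟨fun i => ⟨l[i], hlt _ (List.getElem_mem i.2)⟩, fun i j h =>
      Fin.ext ((hnd.getElem_inj_iff).1 (Fin.mk.inj_iff.1 h))⟩
    refine ⟨t, s, l.length, (G.addClique C).comap e, hexec, ht', ⟨h0, fun i j => ?_⟩, hMk, ?_⟩
    · rw [hmem i i.2 j j.2]
      exact RAM.newAdj_eq G hHC e (fun _ => rfl) i j
    · refine G.isHamiltonian_iff_of_auction (C := C) (fun v hv => (Finset.mem_filter.1 hv).2)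
        (fun i j => ?_) hHC hI e (fun v hv => ?_) (by omega) (by omega)
      · rw [RAM.adjMat_fin]
        simp
      · have hv' : (v : ℕ) ∈ l := by
          refine hkeep v v.2 ?_
          rcases hv with hv | hv
          · have := (hHC v).not.2 hv
            omega
          · omega
        obtain ⟨i, hi, hiv⟩ := List.getElem_of_mem hv'
        exact ⟨⟨i, hi⟩, Fin.ext hiv⟩
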